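/- Plane graphs are finite, may have multiple edges, are embedded in the sphere, and are considered up to isomorphism of plane graphs (orientation preserving or reversing). A \emph{$4$-hedrite} is a $2$-connected $4$-valent plane graph all of whose faces are $2$-, $3$- or $4$-gons, with exactly $p_2=4$ faces that are $2$-gons (by Euler's formula it then has no $3$-gons). A \emph{central circuit} is a circuit obtained by starting with an edge and continuing at each vertex by the edge opposite to the entering one; the central circuits partition the edge set. A \emph{rail-road} is a circuit of $4$-gonal faces (possibly self-intersecting) in which every $4$-gon is adjacent to its two neighbours on opposite edges; a graph is \emph{irreducible} if it has no rail-road. A \emph{$t$-inflation} along a central circuit $C$ ($t\ge 1$) replaces $C$ by $t$ parallel copies of $C$, consecutive copies bounding a rail-road. (i) Every $4$-hedrite $G$ can be obtained from some $4$-hedrite with exactly two central circuits by simultaneous $t_1$- and $t_2$-inflation ($t_1,t_2\ge 1$) along those two circuits; and whenever $G$ is obtained in this way, $G$ is irreducible if and only if $t_1=t_2=1$. (ii) Let $G$ be a $4$-hedrite with $n$ vertices and exactly two central circuits. Then $n$ is even. For each choice of one of the two central circuits as the ``horizontal'' circuit $C$, there is exactly one integer $j$ with $0\le j\le n/4$ (the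 \emph{shift} of $G$ relative to $C$) such that one can move along $C$, passing exactly $j$ vertices, from an edge of $C$ that bounds a $2$-gon on one side of $C$ to an edge of $C$ that bounds a $2$-gon on the other side of $C$; and $\gcd(n/2,j)=1$. The graph is determined by $n$ and a shift: two $4$-hedrites with exactly two central circuits, with the same number of vertices and with the same shift $j$ relative to some central circuit of each, are isomorphic. Conversely, for every even $n$ and every integer $j$ with $0\le j\le n/4$ and $\gcd(n/2,j)=1$ there is such a $4$-hedrite with $n$ vertices and shift $j$ relative to one of its central circuits. Different values of the shift can yield the same graph: some $4$-hedrite with exactly two central circuits has different shifts relative to its two circuits. (iii) Every $4$-hedrite is balanced, that is, any two of its central circuits of the same length have the same intersection vector, where the intersection vector of a central circuit $C$ consists of the number of self-intersections of $C$ and of the sizes, with multiplicities, of the intersections of $C$ with the other central circuits. -/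

import Mathlib

/-- A finite `4`-valent graph (loops and multiple edges allowed) embedded cellularly in a closed
oriented surface, given by its rotation system. A dart is an edge with a direction, based at its
initial vertex. `rot` sends a dart to the next dart at the same vertex in counterclockwise order,
`rev` reverses a dart. Every `rot`-orbit has exactly four elements. -/
structure FourValentMap where
  Dart : Type
  finite_dart : Finite Dart
  rot : Equiv.Perm Dart
  rev : Equiv.Perm Dart
  rot_four : ∀ d, rot (rot (rot (rot d))) = d
  rot_two_ne : ∀ d, rot (rot d) ≠ d
  rev_rev : ∀ d, rev (rev d) = d
  rev_ne : ∀ d, rev d ≠ d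

namespace FourValentMap

/-- The face permutation: `face d` follows `d` on the boundary of the face to the left of `d`. -/
def face (G : FourValentMap) : Equiv.Perm G.Dart := G.rot⁻¹ * G.rev

/-- Vertices, edges and faces are the orbits of `rot`, `rev` and `face`. -/
def Vertex (G : FourValentMap) : Type := Quotient (Equiv.Perm.SameCycle.setoid G.rot)

def Edge (G : FourValentMap) : Type := Quotient (Equiv.Perm.SameCycle.setoid G.rev)

def Face (G : FourValentMap) : Type := Quotient (Equiv.Perm.SameCycle.setoid G.face)

/-- The initial vertex of a dart. -/
def vertexOf (G : FourValentMap) (d : G.Dart) : G.Vertex := Quotient.mk _ d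

/-- The underlying edge of a dart. -/
def edgeOf (G : FourValentMap) (d : G.Dart) : G.Edge := Quotient.mk _ d

/-- The face to the left of a dart. -/
def leftFace (G : FourValentMap) (d : G.Dart) : G.Face := Quotient.mk _ d

/-- The face to the right of a dart. -/
def rightFace (G : FourValentMap) (d : G.Dart) : G.Face := G.leftFace (G.rev d)

noncomputable def numVertices (G : FourValentMap) : ℕ := Nat.card G.Vertex

noncomputable def numEdges (G : FourValentMap) : ℕ := Nat.card G.Edge

noncomputable def numFaces (G : FourValentMap) : ℕ := Nat.card G.Face

/-- A face is a `k`-gon if its boundary walk has length `k`. -/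
def IsGon (G : FourValentMap) (k : ℕ) (f : G.Face) : Prop :=
  Nat.card {d : G.Dart // G.leftFace d = f} = k

/-- The number `p_k` of `k`-gonal faces. -/
noncomputable def numGons (G : FourValentMap) (k : ℕ) : ℕ := Nat.card {f : G.Face // G.IsGon k f}

def Adj (G : FourValentMap) (u w : G.Vertex) : Prop :=
  ∃ d, G.vertexOf d = u ∧ G.vertexOf (G.rev d) = w

def IsConnected (G : FourValentMap) : Prop :=
  Nonempty G.Vertex ∧ ∀ u w, Relation.ReflTransGen G.Adj u w

/-- The graph is connected, and stays connected when any one vertex is deleted. -/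
def IsTwoConnected (G : FourValentMap) : Prop :=
  G.IsConnected ∧ ∀ v u w : G.Vertex, u ≠ v → w ≠ v →
    Relation.ReflTransGen (fun x y => G.Adj x y ∧ x ≠ v ∧ y ≠ v) u w

/-- The surface is the sphere. -/
def IsPlane (G : FourValentMap) : Prop :=
  G.IsConnected ∧ (G.numVertices : ℤ) - G.numEdges + G.numFaces = 2

/-- An `i`-hedrite: a `2`-connected plane `4`-valent graph all of whose faces are
`2`-, `3`- or `4`-gons, with `p_2 = 8 - i`. -/
def IsHedrite (G : FourValentMap) (i : ℕ) : Prop :=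
  G.IsPlane ∧ G.IsTwoConnected ∧
    (∀ f : G.Face, G.IsGon 2 f ∨ G.IsGon 3 f ∨ G.IsGon 4 f) ∧ G.numGons 2 + i = 8

/-- Isomorphism of plane graphs; the orientation may be preserved or reversed. -/
def Iso (G H : FourValentMap) : Prop :=
  ∃ e : G.Dart ≃ H.Dart, (∀ d, e (G.rev d) = H.rev (e d)) ∧
    ((∀ d, e (G.rot d) = H.rot (e d)) ∨ (∀ d, e (G.rot d) = H.rot⁻¹ (e d)))

/-! ### Central circuits -/

/-- One step along a central circuit: run through `d`, then leave its terminal vertex by the edge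
opposite to the entering one. -/
def next (G : FourValentMap) : Equiv.Perm G.Dart := G.rot * G.rot * G.rev

/-- Two darts lie on the same central circuit (traversed in either direction) if they are linked by
reversals and by passages to the opposite dart at a vertex. -/
def circuitSetoid (G : FourValentMap) : Setoid G.Dart :=
  MulAction.orbitRel (Subgroup.closure {G.rot * G.rot, G.rev} : Subgroup (Equiv.Perm G.Dart)) G.Dart

def CentralCircuit (G : FourValentMap) : Type := Quotient G.circuitSetoid

/-- The central circuit through a dart. -/
def circuitOf (G : FourValentMap) (d : G.Dart) : G.CentralCircuit := Quotient.mk _ d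

theorem circuitOf_rev (G : FourValentMap) (d : G.Dart) :
    G.circuitOf (G.rev d) = G.circuitOf d :=
  Quotient.sound ⟨⟨G.rev, Subgroup.subset_closure (by simp)⟩, rfl⟩

theorem circuitOf_rot_rot (G : FourValentMap) (d : G.Dart) :
    G.circuitOf (G.rot (G.rot d)) = G.circuitOf d :=
  Quotient.sound ⟨⟨G.rot * G.rot, Subgroup.subset_closure (by simp)⟩, rfl⟩

/-- The number of edges of a central circuit. -/
noncomputable def length (G : FourValentMap) (C : G.CentralCircuit) : ℕ :=
  Nat.card {e : G.Edge // ∃ d, G.edgeOf d = e ∧ G.circuitOf d = C}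

/-- The number of vertices at which a central circuit crosses itself. -/
noncomputable def selfIntersections (G : FourValentMap) (C : G.CentralCircuit) : ℕ :=
  Nat.card {v : G.Vertex // ∀ d, G.vertexOf d = v → G.circuitOf d = C}

/-- The number of common vertices of two different central circuits. -/
noncomputable def intersections (G : FourValentMap) (C C' : G.CentralCircuit) : ℕ :=
  Nat.card {v : G.Vertex //
    (∃ d, G.vertexOf d = v ∧ G.circuitOf d = C) ∧ (∃ d, G.vertexOf d = v ∧ G.circuitOf d = C')}

/-- The intersection vector of `C`: the number of self-intersections, and for every `k` the number
of other central circuits which meet `C` in exactly `k` vertices. -/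
noncomputable def intersectionVector (G : FourValentMap) (C : G.CentralCircuit) : ℕ × (ℕ → ℕ) :=
  (G.selfIntersections C,
    fun k => Nat.card {C' : G.CentralCircuit // C' ≠ C ∧ G.intersections C C' = k})

/-- Central circuits of the same length have the same intersection vector. -/
def IsBalanced (G : FourValentMap) : Prop :=
  ∀ C C' : G.CentralCircuit, G.length C = G.length C' →
    G.intersectionVector C = G.intersectionVector C'

/-! ### Rail-roads -/

/-- A rail-road: a cyclic sequence of `4`-gons, where `r i` is the side through which the `i`-th
`4`-gon is entered (with the `4`-gon on its left), and the `4`-gon is left through the opposite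
side, into the next one. -/
def IsRailRoad (G : FourValentMap) {m : ℕ} (r : ZMod m → G.Dart) : Prop :=
  ∀ i, G.IsGon 4 (G.leftFace (r i)) ∧ r (i + 1) = G.rev (G.face (G.face (r i)))

def IsIrreducible (G : FourValentMap) : Prop :=
  ¬ ∃ (m : ℕ) (r : ZMod m → G.Dart), 0 < m ∧ G.IsRailRoad r

/-! ### Inflation -/

/-- The number of parallel copies of the central circuit through `d`. -/
def mult (G : FourValentMap) (t : G.CentralCircuit → ℕ+) (d : G.Dart) : ℕ := t (G.circuitOf d)

theorem mult_rev (G : FourValentMap) (t : G.CentralCircuit → ℕ+) (d : G.Dart) :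
    G.mult t (G.rev d) = G.mult t d := by
  simp [mult, circuitOf_rev]

theorem mult_rot_rot (G : FourValentMap) (t : G.CentralCircuit → ℕ+) (d : G.Dart) :
    G.mult t (G.rot (G.rot d)) = G.mult t d := by
  simp [mult, circuitOf_rot_rot]

theorem mult_pos (G : FourValentMap) (t : G.CentralCircuit → ℕ+) (d : G.Dart) :
    0 < G.mult t d := (t (G.circuitOf d)).pos

/-- The darts of the inflation, in which every central circuit `C` is replaced by `t C` parallel
copies. A vertex where `C` and `C'` cross becomes a grid of `t C * t C'` vertices. The triple
`(d, a, b)` is the dart with the direction of `d` at the grid vertex with coordinate `a` in the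
direction of `d` and coordinate `b` in the direction of `rot d`. -/
def IsInflatedDart (G : FourValentMap) (t : G.CentralCircuit → ℕ+) (x : G.Dart × ℕ × ℕ) : Prop :=
  x.2.1 < G.mult t (G.rot x.1) ∧ x.2.2 < G.mult t x.1

/-- Turn a quarter counterclockwise at the same grid vertex. -/
def inflatedRot (G : FourValentMap) (t : G.CentralCircuit → ℕ+) (x : G.Dart × ℕ × ℕ) :
    G.Dart × ℕ × ℕ :=
  (G.rot x.1, x.2.2, G.mult t (G.rot x.1) - 1 - x.2.1)

/-- Inside a grid, a dart ends at the neighbouring grid vertex. On the border of the grid, it runs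
along a copy of the old edge, and ends on the border of the grid at the other end of that edge. -/
def inflatedRev (G : FourValentMap) (t : G.CentralCircuit → ℕ+) (x : G.Dart × ℕ × ℕ) :
    G.Dart × ℕ × ℕ :=
  if x.2.1 + 1 < G.mult t (G.rot x.1) then
    (G.rot (G.rot x.1), G.mult t (G.rot x.1) - 1 - (x.2.1 + 1), G.mult t x.1 - 1 - x.2.2)
  else
    (G.rev x.1, G.mult t (G.rot (G.rev x.1)) - 1, G.mult t x.1 - 1 - x.2.2)

theorem isInflatedDart_rot (G : FourValentMap) (t : G.CentralCircuit → ℕ+) (x : G.Dart × ℕ × ℕ)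
    (hx : G.IsInflatedDart t x) : G.IsInflatedDart t (G.inflatedRot t x) := by
  obtain ⟨d, a, b⟩ := x
  have h := G.mult_rot_rot t d
  simp only [IsInflatedDart, inflatedRot] at hx ⊢
  omega

theorem isInflatedDart_rev (G : FourValentMap) (t : G.CentralCircuit → ℕ+) (x : G.Dart × ℕ × ℕ)
    (hx : G.IsInflatedDart t x) : G.IsInflatedDart t (G.inflatedRev t x) := by
  obtain ⟨d, a, b⟩ := x
  have h1 := G.mult_rot_rot t d
  have h2 := G.mult_rot_rot t (G.rot d)
  have h3 := G.mult_rev t d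
  have h4 := G.mult_pos t (G.rot (G.rev d))
  simp only [IsInflatedDart, inflatedRev] at hx ⊢
  split_ifs <;> dsimp only <;> omega

theorem inflatedRot_four (G : FourValentMap) (t : G.CentralCircuit → ℕ+) (x : G.Dart × ℕ × ℕ)
    (hx : G.IsInflatedDart t x) :
    G.inflatedRot t (G.inflatedRot t (G.inflatedRot t (G.inflatedRot t x))) = x := by
  obtain ⟨d, a, b⟩ := x
  have h1 := G.mult_rot_rot t d
  have h2 := G.mult_rot_rot t (G.rot d)
  have h3 := G.rot_four d
  simp only [IsInflatedDart] at hx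
  simp only [inflatedRot, h3, Prod.mk.injEq, true_and]
  omega

theorem inflatedRev_inflatedRev (G : FourValentMap) (t : G.CentralCircuit → ℕ+)
    (x : G.Dart × ℕ × ℕ) (hx : G.IsInflatedDart t x) :
    G.inflatedRev t (G.inflatedRev t x) = x := by
  obtain ⟨d, a, b⟩ := x
  have h1 := G.mult_rot_rot t d
  have h2 := G.mult_rot_rot t (G.rot d)
  have h3 := G.rot_four d
  have h4 := G.mult_rev t d
  have h5 := G.rev_rev d
  have h6 := G.mult_pos t (G.rot (G.rev d))
  simp only [IsInflatedDart] at hx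
  by_cases h : a + 1 < G.mult t (G.rot d)
  · have h' : G.mult t (G.rot d) - 1 - (a + 1) + 1 < G.mult t (G.rot (G.rot (G.rot d))) := by
      omega
    simp only [inflatedRev, h, h', if_true, h3, Prod.mk.injEq, true_and]
    omega
  · have h' : ¬ G.mult t (G.rot (G.rev d)) - 1 + 1 < G.mult t (G.rot (G.rev d)) := by omega
    simp only [inflatedRev, h, h', if_false, h5, Prod.mk.injEq, true_and]
    omega

theorem inflatedRev_fst_ne (G : FourValentMap) (t : G.CentralCircuit → ℕ+)
    (x : G.Dart × ℕ × ℕ) : (G.inflatedRev t x).1 ≠ x.1 := by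
  unfold inflatedRev
  split_ifs
  · exact G.rot_two_ne x.1
  · exact G.rev_ne x.1

/-- The simultaneous inflation of `G`, `t C`-fold along each central circuit `C`. -/
def inflate (G : FourValentMap) (t : G.CentralCircuit → ℕ+) : FourValentMap where
  Dart := {x : G.Dart × ℕ × ℕ // G.IsInflatedDart t x}
  finite_dart := by
    have := G.finite_dart
    refine Finite.of_injective
      (β := Σ d : G.Dart, Fin (G.mult t (G.rot d)) × Fin (G.mult t d))
      (fun x => ⟨x.1.1, ⟨x.1.2.1, x.2.1⟩, ⟨x.1.2.2, x.2.2⟩⟩) ?_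
    rintro ⟨⟨d, a, b⟩, ha, hb⟩ ⟨⟨d', a', b'⟩, ha', hb'⟩ h
    simp only [Sigma.mk.injEq] at h
    obtain ⟨rfl, h⟩ := h
    simp only [heq_eq_eq, Prod.mk.injEq, Fin.mk.injEq] at h
    obtain ⟨rfl, rfl⟩ := h
    rfl
  rot :=
    { toFun := fun x => ⟨G.inflatedRot t x.1, G.isInflatedDart_rot t _ x.2⟩
      invFun := fun x => ⟨G.inflatedRot t (G.inflatedRot t (G.inflatedRot t x.1)),
        G.isInflatedDart_rot t _ (G.isInflatedDart_rot t _ (G.isInflatedDart_rot t _ x.2))⟩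
      left_inv := fun x => Subtype.ext (G.inflatedRot_four t x.1 x.2)
      right_inv := fun x => Subtype.ext (G.inflatedRot_four t x.1 x.2) }
  rev :=
    { toFun := fun x => ⟨G.inflatedRev t x.1, G.isInflatedDart_rev t _ x.2⟩
      invFun := fun x => ⟨G.inflatedRev t x.1, G.isInflatedDart_rev t _ x.2⟩
      left_inv := fun x => Subtype.ext (G.inflatedRev_inflatedRev t x.1 x.2)
      right_inv := fun x => Subtype.ext (G.inflatedRev_inflatedRev t x.1 x.2) }
  rot_four := fun x => Subtype.ext (G.inflatedRot_four t x.1 x.2)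
  rot_two_ne := fun x h => G.rot_two_ne x.1.1 (congrArg (fun y => y.1.1) h)
  rev_rev := fun x => Subtype.ext (G.inflatedRev_inflatedRev t x.1 x.2)
  rev_ne := fun x h => G.inflatedRev_fst_ne t x.1 (congrArg (fun y => y.1.1) h)

/-! ### Shift -/

/-- `j` is the number of vertices met when one moves along the central circuit `C` from an edge
which bounds a `2`-gon on one side of `C` to an edge which bounds a `2`-gon on the other side. -/
def IsShift (G : FourValentMap) (C : G.CentralCircuit) (j : ℕ) : Prop :=
  ∃ d, G.circuitOf d = C ∧
    ((G.IsGon 2 (G.leftFace d) ∧ G.IsGon 2 (G.rightFace ((G.next ^ j) d))) ∨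
      (G.IsGon 2 (G.rightFace d) ∧ G.IsGon 2 (G.leftFace ((G.next ^ j) d))))

end FourValentMap

/-! ### Counting darts and faces; consequences of Euler's formula -/

namespace FourValentMap

/-! All faces of a `4`-hedrite are `2`-gons or `4`-gons, so the fourth power of `face` is trivial.
Together with `rot ^ 4 = 1` and `rev ^ 2 = 1` this makes the group acting on the darts a quotient of
the rotation group of the square grid, and by connectedness the grid covers the whole map
(`Development.exists_of_face_four`). Geometrically, the sphere is a pillow: the plane modulo a group
of translations and half turns, and the digons are unit squares folded by the half turn about their
centre. With the origin chosen at a digon, the deck group consists of the translations by `2 L` and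
the half turns about `(1/2, 1/2) + L`, for a lattice `L` (`IsHedrite.exists_grid`). Two maps with
the same `L`, up to reflection, are isomorphic (`Grid.iso_of_lattice`), so the theorem becomes
arithmetic of lattices of finite index in `ℤ × ℤ`.

The dictionary is as follows. The unit square at `(x, y)` covers a digon exactly when `(x, y) ∈ L`.
Central circuits are images of horizontal and of vertical lines, and each vertex is a crossing of
one of each kind. Which parallel lines are identified depends only on the projections `v ℤ` and `h
ℤ` of `L` to the two axes. A rail-road is a row or column of squares that avoids `L`. Hence having
exactly two circuits and being irreducible both mean `v = h = 1` (`Grid.IsFull`). Inflation applies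
`diag (v, h)` to the lattice (`Grid.exists_grid_inflate`), and every `L` is `diag (v, h)` applied to
a full lattice (`exists_normal_form`); this gives (i).

A full lattice has the form `{(x, y) | u ∣ x - s y}` with `u` and `s` coprime. The map then has `2
u` vertices, and a shift is a nonnegative integer congruent to `s` or `-s` modulo `u`, the sign
being absorbed by a reflection. All such lattices are realised by `spiral u s`. A quarter turn
exchanges the two circuits and replaces `s` by an inverse modulo `u`, up to sign, so the two shifts
may differ. This gives (ii).

For (iii), parallel circuits are disjoint, and all pairs of a horizontal and a vertical circuit meet
equally often. The lengths are `2 v u` and `2 h u`, so equal lengths in different directions force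
`v = h`; then horizontal and vertical circuits are equally numerous. -/

instance (G : FourValentMap) : Finite G.Dart := G.finite_dart

instance (G : FourValentMap) : Finite G.Vertex := Quotient.finite _

instance (G : FourValentMap) : Finite G.Edge := Quotient.finite _

instance (G : FourValentMap) : Finite G.Face := Quotient.finite _

instance (G : FourValentMap) : Finite G.CentralCircuit := Quotient.finite _

/-- Orbit-stabiliser for the cyclic group generated by `f`. It turns the size of a face into the
minimal period of `face`. -/
theorem card_fiber_sameCycle {α : Type*} (f : Equiv.Perm α) (d : α) :
    Nat.card {d' : α // (Quotient.mk (Equiv.Perm.SameCycle.setoid f) d') = Quotient.mk _ d} =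
      Function.minimalPeriod f d := by
  rw [← Nat.card_zmod (Function.minimalPeriod f d)]
  refine Nat.card_congr (Equiv.trans (Equiv.subtypeEquivRight fun d' => ?_)
    (MulAction.orbitZPowersEquiv f d))
  rw [Quotient.eq, MulAction.mem_orbit_iff]
  constructor
  · intro h
    obtain ⟨i, hi⟩ := Equiv.Perm.SameCycle.symm h
    exact ⟨⟨f ^ i, i, rfl⟩, hi⟩
  · rintro ⟨⟨g, i, rfl⟩, hi⟩
    exact Equiv.Perm.SameCycle.symm ⟨i, hi⟩

theorem card_eq_sum_minimalPeriod {α : Type*} [Finite α] (f : Equiv.Perm α)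
    [Fintype (Quotient (Equiv.Perm.SameCycle.setoid f))] :
    Nat.card α = ∑ q : Quotient (Equiv.Perm.SameCycle.setoid f),
      Nat.card {d : α // Quotient.mk (Equiv.Perm.SameCycle.setoid f) d = q} := by
  rw [← Nat.card_sigma]
  exact Nat.card_congr (Equiv.sigmaFiberEquiv _).symm

theorem card_eq_mul_of_minimalPeriod {α : Type*} [Finite α] (f : Equiv.Perm α) (n : ℕ)
    (h : ∀ d, Function.minimalPeriod f d = n) :
    Nat.card α = n * Nat.card (Quotient (Equiv.Perm.SameCycle.setoid f)) := by
  have := Fintype.ofFinite (Quotient (Equiv.Perm.SameCycle.setoid f))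
  rw [card_eq_sum_minimalPeriod f, Finset.sum_congr rfl (fun q _ => ?_) (g := fun _ => n)]
  · simp [Nat.card_eq_fintype_card, mul_comm]
  · induction q using Quotient.inductionOn with
    | h d => rw [card_fiber_sameCycle, h]

variable (G : FourValentMap)

theorem rot_ne (d : G.Dart) : G.rot d ≠ d := fun h => G.rot_two_ne d (by rw [h, h])

theorem rot_face (d : G.Dart) : G.rot (G.face d) = G.rev d := by
  simp [face]

theorem minimalPeriod_rot (d : G.Dart) : Function.minimalPeriod G.rot d = 4 := by
  have h4 : Function.minimalPeriod G.rot d ∣ 2 ^ 2 :=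
    Function.IsPeriodicPt.minimalPeriod_dvd (n := 4) (G.rot_four d)
  have h2 : ¬ Function.minimalPeriod G.rot d ∣ 2 := fun h =>
    G.rot_two_ne d (Function.isPeriodicPt_iff_minimalPeriod_dvd.2 h)
  obtain ⟨k, hk, he⟩ := (Nat.dvd_prime_pow Nat.prime_two).1 h4
  rw [he] at h2 ⊢
  interval_cases k <;> simp_all

theorem minimalPeriod_rev (d : G.Dart) : Function.minimalPeriod G.rev d = 2 := by
  have h2 : Function.minimalPeriod G.rev d ∣ 2 :=
    Function.IsPeriodicPt.minimalPeriod_dvd (n := 2) (G.rev_rev d)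
  rcases (Nat.dvd_prime Nat.prime_two).1 h2 with h | h
  · exact absurd (Function.minimalPeriod_eq_one_iff_isFixedPt.1 h) (G.rev_ne d)
  · exact h

theorem card_dart_eq_four_mul : Nat.card G.Dart = 4 * G.numVertices :=
  card_eq_mul_of_minimalPeriod G.rot 4 G.minimalPeriod_rot

theorem card_dart_eq_two_mul : Nat.card G.Dart = 2 * G.numEdges :=
  card_eq_mul_of_minimalPeriod G.rev 2 G.minimalPeriod_rev

theorem isGon_leftFace_iff (k : ℕ) (d : G.Dart) :
    G.IsGon k (G.leftFace d) ↔ Function.minimalPeriod G.face d = k := by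
  rw [← card_fiber_sameCycle]; rfl

/-- The lengths of the faces count the darts. -/
theorem card_dart_eq_of_gons (h : ∀ f : G.Face, G.IsGon 2 f ∨ G.IsGon 3 f ∨ G.IsGon 4 f) :
    Nat.card G.Dart = 2 * G.numGons 2 + 3 * G.numGons 3 + 4 * G.numGons 4 ∧
      G.numFaces = G.numGons 2 + G.numGons 3 + G.numGons 4 := by
  classical
  have := Fintype.ofFinite G.Face
  have hn (k : ℕ) : G.numGons k = ∑ f : G.Face, if G.IsGon k f then 1 else 0 := by
    simp [numGons, Nat.card_eq_fintype_card, Fintype.card_subtype]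
  have hc : Nat.card G.Dart = ∑ f : G.Face, Nat.card {d : G.Dart // G.leftFace d = f} := by
    rw [← Nat.card_sigma]
    exact Nat.card_congr (Equiv.sigmaFiberEquiv _).symm
  have hF : G.numFaces = ∑ f : G.Face, 1 := by simp [numFaces, Nat.card_eq_fintype_card]
  rw [hc, hF, hn, hn, hn]
  simp only [Finset.mul_sum, ← Finset.sum_add_distrib]
  constructor <;> refine Finset.sum_congr rfl fun f _ => ?_ <;>
    have hf := h f <;> simp only [IsGon] at hf ⊢ <;> rcases hf with hf | hf | hf <;> simp [hf]

theorem isPlane_iff : G.IsPlane ↔ G.IsConnected ∧ G.numFaces = G.numVertices + 2 := by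
  have h1 := G.card_dart_eq_four_mul
  have h2 := G.card_dart_eq_two_mul
  unfold IsPlane
  refine and_congr_right fun _ => ?_
  omega

variable {G}

/-- A `4`-hedrite has no `3`-gons. -/
theorem IsHedrite.isGon (hG : G.IsHedrite 4) (f : G.Face) : G.IsGon 2 f ∨ G.IsGon 4 f := by
  obtain ⟨hp, -, hf, h2⟩ := hG
  have h1 := G.card_dart_eq_four_mul
  have h3 := (G.isPlane_iff.1 hp).2
  obtain ⟨h4, h5⟩ := G.card_dart_eq_of_gons hf
  -- Counting darts by vertices and by faces, with `F = V + 2`, gives `2 p₂ + p₃ = 8`.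
  have h6 : G.numGons 3 = 0 := by omega
  have h7 : IsEmpty {f : G.Face // G.IsGon 3 f} := (Finite.card_eq_zero_iff).1 h6
  rcases hf f with h | h | h
  · exact .inl h
  · exact (h7.false ⟨f, h⟩).elim
  · exact .inr h

/-- The same count read backwards: four digons and otherwise `4`-gons force `F = V + 2`, so
planarity of a constructed map needs no separate verification. -/
theorem isHedrite_four_iff : G.IsHedrite 4 ↔ G.IsTwoConnected ∧
    (∀ f : G.Face, G.IsGon 2 f ∨ G.IsGon 4 f) ∧ G.numGons 2 = 4 := by
  constructor
  · exact fun h => ⟨h.2.1, h.isGon, by have := h.2.2.2; omega⟩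
  · rintro ⟨hc, hf, h2⟩
    have hf' : ∀ f : G.Face, G.IsGon 2 f ∨ G.IsGon 3 f ∨ G.IsGon 4 f := fun f =>
      (hf f).imp_right .inr
    refine ⟨G.isPlane_iff.2 ⟨hc.1, ?_⟩, hc, hf', by omega⟩
    have h1 := G.card_dart_eq_four_mul
    obtain ⟨h4, h5⟩ := G.card_dart_eq_of_gons hf'
    have h6 : G.numGons 3 = 0 := by
      refine Finite.card_eq_zero_iff.2 ⟨fun ⟨f, h⟩ => ?_⟩
      rcases hf f with h' | h' <;> simp only [IsGon] at h h' <;> omega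
    omega

/-- If all faces are `2`-gons and `4`-gons, then the fourth power of `face` is trivial. -/
theorem face_four_of_isGon (h : ∀ f : G.Face, G.IsGon 2 f ∨ G.IsGon 4 f) (d : G.Dart) :
    G.face (G.face (G.face (G.face d))) = d := by
  have : Function.minimalPeriod G.face d ∣ 4 := by
    rcases h (G.leftFace d) with h | h <;> rw [isGon_leftFace_iff] at h <;> rw [h]; norm_num
  exact Function.isPeriodicPt_iff_minimalPeriod_dvd.2 this

theorem face_ne_of_isGon (h : ∀ f : G.Face, G.IsGon 2 f ∨ G.IsGon 4 f) (d : G.Dart) :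
    G.face d ≠ d := by
  intro hd
  have h1 := Function.minimalPeriod_eq_one_iff_isFixedPt.2 hd
  rcases h (G.leftFace d) with h | h <;> rw [isGon_leftFace_iff] at h <;> omega

theorem isGon_two_iff (hn : ∀ d, G.face d ≠ d) (d : G.Dart) :
    G.IsGon 2 (G.leftFace d) ↔ G.face (G.face d) = d := by
  rw [isGon_leftFace_iff]
  constructor
  · intro h
    exact Function.isPeriodicPt_iff_minimalPeriod_dvd.2 h.dvd
  · intro h
    have h2 : Function.minimalPeriod G.face d ∣ 2 :=
      Function.IsPeriodicPt.minimalPeriod_dvd (n := 2) h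
    rcases (Nat.dvd_prime Nat.prime_two).1 h2 with h | h
    · exact absurd (Function.minimalPeriod_eq_one_iff_isFixedPt.1 h) (hn d)
    · exact h

theorem isGon_four_iff (h4 : ∀ d, G.face (G.face (G.face (G.face d))) = d) (d : G.Dart) :
    G.IsGon 4 (G.leftFace d) ↔ G.face (G.face d) ≠ d := by
  rw [isGon_leftFace_iff]
  constructor
  · intro h h2
    have := Function.IsPeriodicPt.minimalPeriod_dvd (f := G.face) (x := d) (n := 2) h2
    rw [h] at this; norm_num at this
  · intro h
    have h4 : Function.minimalPeriod G.face d ∣ 2 ^ 2 :=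
      Function.IsPeriodicPt.minimalPeriod_dvd (n := 4) (h4 d)
    have h2 : ¬ Function.minimalPeriod G.face d ∣ 2 := fun h' =>
      h (Function.isPeriodicPt_iff_minimalPeriod_dvd.2 h')
    obtain ⟨k, hk, he⟩ := (Nat.dvd_prime_pow Nat.prime_two).1 h4
    rw [he] at h2 ⊢
    interval_cases k <;> simp_all

theorem IsHedrite.exists_digon (hG : G.IsHedrite 4) : ∃ d, G.face (G.face d) = d := by
  have h2 := (isHedrite_four_iff.1 hG).2.2
  have : Nonempty {f : G.Face // G.IsGon 2 f} := (Nat.card_pos_iff.1 (by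
    show 0 < G.numGons 2; omega)).1
  obtain ⟨f, hf⟩ := this
  obtain ⟨d, rfl⟩ := Quotient.exists_rep f
  exact ⟨d, (isGon_two_iff (face_ne_of_isGon hG.isGon) d).1 hf⟩

/-- A nonempty set of darts stable under `rot` and `rev` is everything. -/
theorem IsConnected.forall_dart (hG : G.IsConnected) {p : G.Dart → Prop} {d₀ : G.Dart}
    (h0 : p d₀) (hrot : ∀ d, p d → p (G.rot d)) (hrev : ∀ d, p d → p (G.rev d)) (d : G.Dart) :
    p d := by
  have hs : ∀ d d', G.vertexOf d = G.vertexOf d' → p d → p d' := by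
    intro d d' h hp
    obtain ⟨i, hi⟩ := (Quotient.exact h : Equiv.Perm.SameCycle G.rot d d').exists_nat_pow_eq
    rw [← hi]
    clear hi
    induction i with
    | zero => exact hp
    | succ i ih => rw [pow_succ']; exact hrot _ ih
  have key : ∀ w, Relation.ReflTransGen G.Adj (G.vertexOf d₀) w → ∀ d, G.vertexOf d = w → p d := by
    intro w hw
    induction hw with
    | refl => exact fun d hd => hs _ _ hd.symm h0
    | tail _ hab ih =>
      obtain ⟨d, hd, rfl⟩ := hab
      exact fun d' hd' => hs _ _ hd'.symm (hrev _ (ih d hd))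
  exact key _ (hG.2 _ _) d rfl

end FourValentMap

/-! ### Covering the map by the square grid -/

namespace FourValentMap

/-- The unit vector in direction `k`, a multiple of a quarter turn, is `(dirX k, dirY k)`. -/
def dirX (k : ZMod 4) : ℤ := if k = 0 then 1 else if k = 2 then -1 else 0

def dirY (k : ZMod 4) : ℤ := if k = 1 then 1 else if k = 3 then -1 else 0

theorem dirX_add_one : ∀ k, dirX (k + 1) = -dirY k := by decide

theorem dirY_add_one : ∀ k, dirY (k + 1) = dirX k := by decide

theorem dirX_sub : ∀ k, dirX (2 - k) = -dirX k := by decide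

theorem dirY_sub : ∀ k, dirY (2 - k) = dirY k := by decide

@[simp] theorem dirX_zero : dirX 0 = 1 := rfl

@[simp] theorem dirX_one : dirX 1 = 0 := rfl

@[simp] theorem dirX_two : dirX 2 = -1 := rfl

@[simp] theorem dirX_three : dirX 3 = 0 := rfl

@[simp] theorem dirY_zero : dirY 0 = 0 := rfl

@[simp] theorem dirY_one : dirY 1 = 1 := rfl

@[simp] theorem dirY_two : dirY 2 = 0 := rfl

@[simp] theorem dirY_three : dirY 3 = -1 := rfl

/-- A covering of `G` by the square grid: `D x y k` is the image of the dart which leaves the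
grid point `(x, y)` in direction `k`. -/
structure Development (G : FourValentMap) where
  D : ℤ → ℤ → ZMod 4 → G.Dart
  rot_D : ∀ x y k, G.rot (D x y k) = D x y (k + 1)
  rev_D : ∀ x y k, G.rev (D x y k) = D (x + dirX k) (y + dirY k) (k + 2)
  surj : ∀ d, ∃ x y k, D x y k = d

namespace Development

variable {G : FourValentMap} (g : G.Development)

theorem rot_pow_D (x y : ℤ) (k : ZMod 4) (n : ℕ) : (G.rot ^ n) (g.D x y k) = g.D x y (k + n) := by
  induction n with
  | zero => simp
  | succ n ih => rw [pow_succ', Equiv.Perm.mul_apply, ih, g.rot_D]; push_cast; rw [add_assoc]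

theorem rot_inv_D (x y : ℤ) (k : ZMod 4) : G.rot⁻¹ (g.D x y k) = g.D x y (k - 1) := by
  rw [Equiv.Perm.inv_eq_iff_eq, g.rot_D, sub_add_cancel]

theorem face_D (x y : ℤ) (k : ZMod 4) :
    G.face (g.D x y k) = g.D (x + dirX k) (y + dirY k) (k + 1) := by
  apply G.rot.injective
  rw [rot_face, g.rev_D, g.rot_D, add_assoc]; rfl

theorem next_D (x y : ℤ) (k : ZMod 4) :
    G.next (g.D x y k) = g.D (x + dirX k) (y + dirY k) k := by
  have h4 : k + 2 + 1 + 1 = k := by revert k; decide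
  simp only [next, Equiv.Perm.mul_apply, g.rev_D, g.rot_D, h4]

theorem next_zpow_D (x y : ℤ) (k : ZMod 4) (j : ℤ) :
    (G.next ^ j) (g.D x y k) = g.D (x + j * dirX k) (y + j * dirY k) k := by
  induction j using Int.induction_on with
  | zero => simp
  | succ j ih =>
    rw [add_comm, zpow_add, Equiv.Perm.mul_apply, ih, zpow_one, next_D]
    congr 1 <;> ring
  | pred j ih =>
    rw [sub_eq_add_neg, add_comm, zpow_add, Equiv.Perm.mul_apply, ih, zpow_neg, zpow_one,
      Equiv.Perm.inv_eq_iff_eq, next_D]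
    congr 1 <;> ring

/-- Two coinciding darts are moved along by equal relative motions. -/
theorem move {x y x' y' : ℤ} {k k' : ZMod 4} (h : g.D x y k = g.D x' y' k') (a b : ℤ)
    (c : ZMod 4) :
    g.D (x + a * dirX k - b * dirY k) (y + a * dirY k + b * dirX k) (k + c) =
      g.D (x' + a * dirX k' - b * dirY k') (y' + a * dirY k' + b * dirX k') (k' + c) := by
  -- Walk `a` steps ahead, turn left, walk `b` steps, then turn to the final direction. The left
  -- turn already contributes one quarter, hence the exponent `c - 1`.
  have h1 := congrArg (fun d => (G.rot ^ (c - 1).val) ((G.next ^ b) (G.rot ((G.next ^ a) d)))) h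
  simp only [next_zpow_D, g.rot_D, rot_pow_D, dirX_add_one, dirY_add_one, ZMod.natCast_zmod_val,
    mul_neg, ← sub_eq_add_neg] at h1
  convert h1 using 1 <;> congr 1 <;> ring

variable {g}

theorem move_zero {x y x' y' : ℤ} (h : g.D x y 0 = g.D x' y' 0) (a b : ℤ) (c : ZMod 4) :
    g.D (x + a) (y + b) c = g.D (x' + a) (y' + b) c := by
  simpa using g.move h a b c

theorem move_two {x y x' y' : ℤ} (h : g.D x y 0 = g.D x' y' 2) (a b : ℤ) (c : ZMod 4) :
    g.D (x + a) (y + b) c = g.D (x' - a) (y' - b) (2 + c) := by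
  have := g.move h a b c
  simpa [sub_eq_add_neg] using this

theorem move_one {x y x' y' : ℤ} (h : g.D x y 0 = g.D x' y' 1) (a b : ℤ) (c : ZMod 4) :
    g.D (x + a) (y + b) c = g.D (x' - b) (y' + a) (1 + c) := by
  have := g.move h a b c
  simpa [sub_eq_add_neg] using this

/-- Such a coincidence is a half turn of the covering. If its centre were a grid point, `rot * rot`
would fix a dart; if it were the midpoint of an edge, `rev` would. Only centres of squares remain.
-/
theorem odd_of_eq_two {x y x' y' : ℤ} (h : g.D x y 0 = g.D x' y' 2) :
    (∃ a, x + x' = 2 * a + 1) ∧ ∃ b, y + y' = 2 * b + 1 := by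
  obtain ⟨a, ha⟩ := Int.even_or_odd' (x' - x)
  obtain ⟨b, hb⟩ := Int.even_or_odd' (y' - y)
  rcases ha with ha | ha <;> rcases hb with hb | hb
  · have h1 := move_two h a b 0
    rw [show x' - a = x + a by omega, show y' - b = y + b by omega] at h1
    refine (G.rot_two_ne (g.D (x + a) (y + b) 0) ?_).elim
    rw [g.rot_D, g.rot_D, h1]; rfl
  · have h1 := move_two h a b 1
    rw [show x' - a = x + a by omega, show y' - b = y + b + 1 by omega] at h1
    refine (G.rev_ne (g.D (x + a) (y + b) 1) ?_).elim
    rw [g.rev_D, h1]; simp; rfl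
  · have h1 := move_two h a b 0
    rw [show x' - a = x + a + 1 by omega, show y' - b = y + b by omega] at h1
    refine (G.rev_ne (g.D (x + a) (y + b) 0) ?_).elim
    rw [g.rev_D, h1]; simp
  · exact ⟨⟨x + a, by omega⟩, ⟨y + b, by omega⟩⟩

/-- A coincidence of this kind is a quarter turn, centred at a grid point or at the centre of a
square according to a parity. The first would give a fixed point of `rot`, the second a face of
length one. -/
theorem ne_one (hn : ∀ d, G.face d ≠ d) (x y x' y' : ℤ) : g.D x y 0 ≠ g.D x' y' 1 := by
  intro h
  obtain ⟨b, hb⟩ := Int.even_or_odd' (x' - x + (y' - y))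
  rcases hb with hb | hb
  · have h1 := move_one h (x' - x - b) b 0
    rw [show x' - b = x + (x' - x - b) by omega, show y' + (x' - x - b) = y + b by omega] at h1
    refine G.rot_ne (g.D (x + (x' - x - b)) (y + b) 0) ?_
    rw [g.rot_D, h1]; rfl
  · have h1 := move_one h (x' - x - 1 - b) b 0
    rw [show x' - b = x + (x' - x - 1 - b) + 1 by omega,
      show y' + (x' - x - 1 - b) = y + b by omega] at h1
    refine hn (g.D (x + (x' - x - 1 - b)) (y + b) 0) ?_
    rw [g.face_D, h1]; simp

/-- `N` is a step forward and `M` a step to the left, both keeping the direction. The relations of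
the map make them commute, so `r ^ k * N ^ x * M ^ y` applied to `d₀` is a well-behaved function of
a grid dart. -/
theorem exists_of_face_four (hG : G.IsConnected)
    (h4 : ∀ d, G.face (G.face (G.face (G.face d))) = d) (d₀ : G.Dart) :
    ∃ g : G.Development, g.D 0 0 0 = d₀ := by
  set r := G.rot with hr
  set N := G.next with hN
  set M := r⁻¹ * N * r with hM
  have hr4 : r ^ 4 = 1 := Equiv.ext fun d => G.rot_four d
  have hv : G.rev * G.rev = 1 := Equiv.ext fun d => G.rev_rev d
  have hrev : G.rev = r ^ 2 * N := by
    rw [hN, next, ← hr, pow_two, ← mul_assoc, ← mul_assoc]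
    rw [show r * r * r * r = r ^ 4 by simp only [pow_succ, pow_zero, one_mul], hr4, one_mul]
  have hface : G.face = r * N := by
    rw [face, hrev, ← hr, pow_two, mul_assoc, inv_mul_cancel_left]
  have h2 : r ^ 2 * N * (r ^ 2 * N) = 1 := hrev ▸ hv
  -- That `rev` is an involution means that the half turn `r ^ 2` conjugates `N` into its inverse.
  have h2' : r ^ 2 * N = N⁻¹ * r ^ 2 := by
    have : r ^ 2 * N = (r ^ 2 * N)⁻¹ := eq_inv_of_mul_eq_one_left h2
    rw [this, mul_inv_rev, inv_eq_of_mul_eq_one_left (a := r ^ 2) (b := r ^ 2)]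
    rw [← pow_add, hr4]
  have hrN : N * r = r * M := by rw [hM]; group
  have hrM : M * r = r * N⁻¹ := by
    rw [hM, eq_comm, ← mul_left_cancel_iff (a := r)]
    calc r * (r * N⁻¹) = r ^ 2 * N⁻¹ := by rw [pow_two, mul_assoc]
      _ = N * (r ^ 2 * N) * N⁻¹ := by rw [h2']; group
      _ = _ := by rw [pow_two]; group
  -- Moving all rotations to the left shows that `face ^ 4` is `r ^ 4` times a commutator of `M` and
  -- `N`. This is where the faces enter.
  have hNM : N * M = M * N := by
    have hf : (r * N) * (r * N) * (r * N) * (r * N) = 1 := by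
      rw [← hface]; exact Equiv.ext fun d => h4 d
    have : r * N * (r * N) * (r * N) * (r * N) = r ^ 4 * (M⁻¹ * N⁻¹ * M * N) := by
      have h5 : N⁻¹ * r = r * M⁻¹ := by
        rw [← mul_right_inj N, ← mul_left_inj M]
        calc N * (N⁻¹ * r) * M = r * M := by group
          _ = N * r := hrN.symm
          _ = N * (r * M⁻¹) * M := by group
      calc r * N * (r * N) * (r * N) * (r * N) = r * (N * r) * (N * r) * (N * r) * N := by group
        _ = r * r * (M * r) * (M * r) * M * N := by rw [hrN]; group
        _ = r * r * r * (N⁻¹ * r) * N⁻¹ * M * N := by rw [hrM]; group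
        _ = _ := by rw [h5]; simp only [pow_succ, pow_zero, one_mul, mul_assoc]
    rw [this, hr4, one_mul] at hf
    calc N * M = N * M * (M⁻¹ * N⁻¹ * M * N) := by rw [hf, mul_one]
      _ = M * N := by group
  have hc : Commute N M := hNM
  have hD (k : ZMod 4) (d : G.Dart) : r ((r ^ k.val) d) = (r ^ (k + 1).val) d := by
    rw [← Equiv.Perm.mul_apply, ← pow_succ']
    congr 1
    fin_cases k
    · rfl
    · rfl
    · rfl
    · exact hr4
  let D : ℤ → ℤ → ZMod 4 → G.Dart := fun x y k => (r ^ k.val) ((N ^ x) ((M ^ y) d₀))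
  have hrot (x y k) : G.rot (D x y k) = D x y (k + 1) := hD k _
  have hr2 : r ^ 2 * r ^ 2 = 1 := by rw [← pow_add, hr4]
  have hN1 (x y : ℤ) : N * (N ^ x * M ^ y) = N ^ (x + 1) * M ^ y := by group
  have hN2 (x y : ℤ) : N⁻¹ * (N ^ x * M ^ y) = N ^ (x - 1) * M ^ y := by group
  have hM1 (x y : ℤ) : M * (N ^ x * M ^ y) = N ^ x * M ^ (y + 1) := by
    rw [← mul_assoc, ← (hc.zpow_left x).eq]; group
  have hM2 (x y : ℤ) : M⁻¹ * (N ^ x * M ^ y) = N ^ x * M ^ (y - 1) := by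
    rw [← mul_assoc, ← (hc.zpow_left x).inv_right.eq]; group
  have hrv (x y k) : G.rev (D x y k) = D (x + dirX k) (y + dirY k) (k + 2) := by
    have key : ∀ f f' : Equiv.Perm G.Dart, r ^ 2 * N * f = f' → G.rev (f d₀) = f' d₀ := by
      rintro f _ rfl
      rw [hrev]; rfl
    have hDe (x y k) : D x y k = (r ^ k.val * (N ^ x * M ^ y)) d₀ := rfl
    rw [hDe, hDe]
    apply key
    have hk : k = 0 ∨ k = 1 ∨ k = 2 ∨ k = 3 := by revert k; decide
    rcases hk with rfl | rfl | rfl | rfl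
    · show r ^ 2 * N * (r ^ 0 * (N ^ x * M ^ y)) = r ^ 2 * (N ^ (x + 1) * M ^ (y + 0))
      rw [← hN1, add_zero, pow_zero, one_mul, mul_assoc]
    · show r ^ 2 * N * (r ^ 1 * (N ^ x * M ^ y)) = r ^ 3 * (N ^ (x + 0) * M ^ (y + 1))
      rw [← hM1, add_zero, pow_one]
      calc _ = r ^ 2 * (N * r) * (N ^ x * M ^ y) := by group
        _ = _ := by rw [hrN]; group
    · show r ^ 2 * N * (r ^ 2 * (N ^ x * M ^ y)) = r ^ 0 * (N ^ (x + -1) * M ^ (y + 0))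
      rw [← sub_eq_add_neg, ← hN2, add_zero, pow_zero, one_mul, h2']
      calc _ = N⁻¹ * (r ^ 2 * r ^ 2) * (N ^ x * M ^ y) := by group
        _ = _ := by rw [hr2, mul_one]
    · show r ^ 2 * N * (r ^ 3 * (N ^ x * M ^ y)) = r ^ 1 * (N ^ (x + 0) * M ^ (y + -1))
      rw [← sub_eq_add_neg, ← hM2, add_zero, pow_one, h2']
      calc _ = N⁻¹ * (r ^ 4) * r * (N ^ x * M ^ y) := by group
        _ = r * (r⁻¹ * N * r)⁻¹ * (N ^ x * M ^ y) := by rw [hr4, mul_one]; group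
        _ = _ := by rw [hM]; group
  refine ⟨⟨D, hrot, hrv, fun d => ?_⟩, rfl⟩
  refine hG.forall_dart (p := fun d => ∃ x y k, D x y k = d) (d₀ := d₀) ⟨0, 0, 0, rfl⟩ ?_ ?_ d
  · rintro _ ⟨x, y, k, rfl⟩
    exact ⟨_, _, _, (hrot x y k).symm⟩
  · rintro _ ⟨x, y, k, rfl⟩
    exact ⟨_, _, _, (hrv x y k).symm⟩

end Development

/-! ### The deck group and its lattice -/

/-- A development whose group of deck transformations consists of the translations by `2 L` and of
the half turns around the points of `(1/2, 1/2) + L`. -/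
structure Grid (G : FourValentMap) extends G.Development where
  L : AddSubgroup (ℤ × ℤ)
  half : D 0 0 0 = D 1 1 2
  zero_iff : ∀ x y x' y', D x y 0 = D x' y' 0 ↔ ∃ a b, (a, b) ∈ L ∧ x' = x + 2 * a ∧ y' = y + 2 * b
  ne_one : ∀ x y x' y', D x y 0 ≠ D x' y' 1

/-- A digon placed at the origin supplies one half turn. Composing a translation with it gives
another half turn; since both are centred at centres of squares, the translation vector is even. -/
theorem IsHedrite.exists_grid {G : FourValentMap} (hG : G.IsHedrite 4) : Nonempty G.Grid := by
  obtain ⟨d₀, hd⟩ := hG.exists_digon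
  obtain ⟨g, rfl⟩ := Development.exists_of_face_four hG.1.1 (face_four_of_isGon hG.isGon) d₀
  have half : g.D 0 0 0 = g.D 1 1 2 := by
    rw [g.face_D, g.face_D] at hd
    exact hd.symm
  have h2 (x y : ℤ) : g.D x y 0 = g.D (1 - x) (1 - y) 2 := by
    simpa using Development.move_two half x y 0
  let L : AddSubgroup (ℤ × ℤ) :=
    { carrier := {p | g.D (2 * p.1) (2 * p.2) 0 = g.D 0 0 0}
      zero_mem' := by simp
      add_mem' := by
        rintro ⟨a, b⟩ ⟨a', b'⟩ h h'
        have := Development.move_zero h (2 * a') (2 * b') 0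
        rw [zero_add, zero_add] at this
        exact (by simpa [mul_add] using this.trans h')
      neg_mem' := by
        rintro ⟨a, b⟩ h
        have := Development.move_zero h (-(2 * a)) (-(2 * b)) 0
        simpa using this.symm }
  refine ⟨⟨g, L, half, fun x y x' y' => ⟨fun h => ?_, ?_⟩,
    g.ne_one (face_ne_of_isGon hG.isGon)⟩⟩
  · obtain ⟨⟨a, ha⟩, ⟨b, hb⟩⟩ := Development.odd_of_eq_two (h.trans (h2 x' y'))
    refine ⟨-a, -b, ?_, by omega, by omega⟩
    have := Development.move_zero h (-x) (-y) 0
    rw [show x' + -x = 2 * -a by omega, show y' + -y = 2 * -b by omega] at this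
    rw [add_neg_cancel, add_neg_cancel] at this
    exact this.symm
  · rintro ⟨a, b, h, rfl, rfl⟩
    have := Development.move_zero (h : g.D (2 * a) (2 * b) 0 = g.D 0 0 0) x y 0
    rw [add_comm x, add_comm y, this, zero_add, zero_add]

end FourValentMap

/-! ### Faces, symmetries and isomorphisms in terms of the lattice -/

namespace FourValentMap

namespace Grid

variable {G : FourValentMap} (g : G.Grid)

theorem half_turn (x y : ℤ) (k : ZMod 4) : g.D x y k = g.D (1 - x) (1 - y) (k + 2) := by
  simpa [add_comm] using Development.move_two g.half x y k

theorem D_add_right {x y x' y' : ℤ} {k k' : ZMod 4} (h : g.D x y k = g.D x' y' k') (c : ZMod 4) :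
    g.D x y (k + c) = g.D x' y' (k' + c) := by
  simpa using g.move h 0 0 c

theorem D_add_right_iff {x y x' y' : ℤ} {k k' : ZMod 4} (c : ZMod 4) :
    g.D x y (k + c) = g.D x' y' (k' + c) ↔ g.D x y k = g.D x' y' k' :=
  ⟨fun h => by simpa using g.D_add_right h (-c), fun h => g.D_add_right h c⟩

/-- After subtracting `k` from both directions, the relative turn is one of four: none is a
translation, a half turn reduces to a translation by `half_turn`, and the quarter turns are excluded
by `ne_one`. -/
theorem eq_iff (x y x' y' : ℤ) (k k' : ZMod 4) : g.D x y k = g.D x' y' k' ↔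
    (k' = k ∧ ∃ a b, (a, b) ∈ g.L ∧ x' = x + 2 * a ∧ y' = y + 2 * b) ∨
    (k' = k + 2 ∧ ∃ a b, (a, b) ∈ g.L ∧ 1 - x' = x + 2 * a ∧ 1 - y' = y + 2 * b) := by
  obtain ⟨c, rfl⟩ : ∃ c, k' = c + k := ⟨k' - k, by ring⟩
  have h := g.D_add_right_iff (x := x) (y := y) (x' := x') (y' := y') (k := 0) (k' := c) k
  rw [zero_add] at h
  rw [h]
  have hc : c = 0 ∨ c = 1 ∨ c = 2 ∨ c = 3 := by
    clear h; revert c; decide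
  have e : ∀ a : ZMod 4, a + k = k + 2 ↔ a = 2 := fun a => by rw [add_comm, add_right_inj]
  simp only [add_eq_right, e]
  rcases hc with rfl | rfl | rfl | rfl
  · rw [g.zero_iff]
    simp [show (0 : ZMod 4) ≠ 2 by decide]
  · simp [show (1 : ZMod 4) ≠ 2 by decide, show (1 : ZMod 4) ≠ 0 by decide, g.ne_one]
  · rw [g.half_turn x' y', show (2 + 2 : ZMod 4) = 0 by decide, g.zero_iff]
    simp [show (2 : ZMod 4) ≠ 0 by decide]
  · simp only [show (3 : ZMod 4) ≠ 2 by decide, show (3 : ZMod 4) ≠ 0 by decide, false_and,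
      or_self, iff_false]
    intro h'
    exact g.ne_one _ _ _ _ (g.D_add_right h' 1).symm

theorem face_ne (g : G.Grid) (d : G.Dart) : G.face d ≠ d := by
  obtain ⟨x, y, k, rfl⟩ := g.surj d
  rw [g.face_D, Ne, g.eq_iff]
  have h1 : ¬ k = k + 1 := by revert k; decide
  have h2 : ¬ k = k + 1 + 2 := by revert k; decide
  simp [h1, h2]

theorem face_four (g : G.Grid) (d : G.Dart) : G.face (G.face (G.face (G.face d))) = d := by
  obtain ⟨x, y, k, rfl⟩ := g.surj d
  simp only [g.face_D, dirX_add_one, dirY_add_one]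
  congr 1
  · ring
  · ring
  · revert k; decide

/-- A square covers a digon exactly when the half turn about its centre is a deck transformation. -/
theorem isGon_two_iff (x y : ℤ) : G.IsGon 2 (G.leftFace (g.D x y 0)) ↔ (x, y) ∈ g.L := by
  rw [FourValentMap.isGon_two_iff g.face_ne, g.face_D, g.face_D, g.eq_iff]
  simp only [zero_add, dirX_zero, dirX_one, dirY_zero, dirY_one, add_zero,
    show (1 + 1 : ZMod 4) = 2 by decide, show (2 + 2 : ZMod 4) = 0 by decide,
    show (0 : ZMod 4) ≠ 2 by decide, false_and, false_or, true_and]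
  constructor
  · rintro ⟨a, b, h, h1, h2⟩
    have := g.L.neg_mem h
    rwa [Prod.neg_mk, show -a = x by omega, show -b = y by omega] at this
  · intro h
    exact ⟨-x, -y, by simpa using g.L.neg_mem h, by omega, by omega⟩

theorem isGon_four_iff (x y : ℤ) : G.IsGon 4 (G.leftFace (g.D x y 0)) ↔ (x, y) ∉ g.L := by
  rw [FourValentMap.isGon_four_iff g.face_four, ← g.isGon_two_iff,
    FourValentMap.isGon_two_iff g.face_ne]

theorem leftFace_face (d : G.Dart) : G.leftFace (G.face d) = G.leftFace d :=
  Quotient.sound ⟨-1, by simp⟩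

theorem leftFace_one (x y : ℤ) : G.leftFace (g.D x y 1) = G.leftFace (g.D (x - 1) y 0) := by
  rw [← leftFace_face (g.D (x - 1) y 0), g.face_D]; simp

theorem rightFace_zero (x y : ℤ) : G.rightFace (g.D x y 0) = G.leftFace (g.D (-x) (1 - y) 0) := by
  rw [rightFace, g.rev_D, g.half_turn]
  congr 2 <;> simp

theorem leftFace_cases (g : G.Grid) (f : G.Face) : ∃ x y, f = G.leftFace (g.D x y 0) := by
  obtain ⟨d, rfl⟩ := Quotient.exists_rep f
  obtain ⟨x, y, k, rfl⟩ := g.surj d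
  have h1 (x y) : ∃ x' y', G.leftFace (g.D x y 1) = G.leftFace (g.D x' y' 0) :=
    ⟨_, _, g.leftFace_one x y⟩
  have hk : k = 0 ∨ k = 1 ∨ k = 2 ∨ k = 3 := by revert k; decide
  rcases hk with rfl | rfl | rfl | rfl
  · exact ⟨x, y, rfl⟩
  · exact h1 x y
  · exact ⟨1 - x, 1 - y, by rw [g.half_turn]; rfl⟩
  · obtain ⟨x', y', h⟩ := h1 (1 - x) (1 - y)
    exact ⟨x', y', by rw [← h, g.half_turn]; rfl⟩

theorem isGon (g : G.Grid) (f : G.Face) : G.IsGon 2 f ∨ G.IsGon 4 f := by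
  obtain ⟨x, y, rfl⟩ := g.leftFace_cases f
  rw [g.isGon_two_iff, g.isGon_four_iff]
  exact em _

/-- The grid turned by a quarter turn. -/
def turn : G.Grid where
  -- The quarter turn is about `(1/2, 1/2)`, so that the square of the base digon is preserved.
  D x y k := g.D (1 - y) x (k + 1)
  rot_D x y k := g.rot_D _ _ _
  rev_D x y k := by
    rw [g.rev_D, dirX_add_one, dirY_add_one]
    congr 1 <;> ring
  surj d := by
    obtain ⟨x, y, k, rfl⟩ := g.surj d
    exact ⟨y, 1 - x, k - 1, by simp⟩
  L :=
    { carrier := {p | (-p.2, p.1) ∈ g.L}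
      zero_mem' := g.L.zero_mem
      add_mem' := by
        rintro ⟨a, b⟩ ⟨a', b'⟩ h h'
        have := g.L.add_mem h h'
        simpa [add_comm] using this
      neg_mem' := by
        rintro ⟨a, b⟩ h
        simpa using g.L.neg_mem h }
  half := by simpa [add_comm] using g.half_turn 1 0 1
  zero_iff x y x' y' := by
    rw [zero_add, show (1 : ZMod 4) = 0 + 1 by decide, g.D_add_right_iff, g.zero_iff]
    constructor
    · rintro ⟨a, b, h, h1, h2⟩
      exact ⟨b, -a, by simpa using h, by omega, by omega⟩
    · rintro ⟨a, b, h, h1, h2⟩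
      exact ⟨-b, a, h, by omega, by omega⟩
  ne_one x y x' y' := by
    rw [Ne, g.D_add_right_iff]
    exact g.ne_one _ _ _ _

theorem mem_turn {a b : ℤ} : (a, b) ∈ g.turn.L ↔ (-b, a) ∈ g.L := Iff.rfl

/-- Grids with the same lattice, up to a reflection, belong to isomorphic maps. -/
theorem iso_of_lattice {H : FourValentMap} (g : G.Grid) (g' : H.Grid) (ε : ℤ) (hε : ε = 1 ∨ ε = -1)
    (h : ∀ a b, (a, b) ∈ g.L ↔ (ε * a, b) ∈ g'.L) : G.Iso H := by
  -- It is enough to cover `H` by the grid, possibly reversing the orientation, with exactly the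
  -- identifications made by `g`.
  suffices hs : ∃ F : ℤ → ℤ → ZMod 4 → H.Dart,
      (∀ x y k x' y' k', g.D x y k = g.D x' y' k' ↔ F x y k = F x' y' k') ∧
      (∀ d, ∃ x y k, F x y k = d) ∧
      (∀ x y k, H.rev (F x y k) = F (x + dirX k) (y + dirY k) (k + 2)) ∧
      ((∀ x y k, H.rot (F x y k) = F x y (k + 1)) ∨
        ∀ x y k, H.rot⁻¹ (F x y k) = F x y (k + 1)) by
    obtain ⟨F, hF, hs, hv, hr⟩ := hs
    choose px py pk hp using g.surj
    have key (x y k) : F (px (g.D x y k)) (py (g.D x y k)) (pk (g.D x y k)) = F x y k :=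
      (hF _ _ _ _ _ _).1 (hp _)
    refine ⟨Equiv.ofBijective (fun d => F (px d) (py d) (pk d)) ⟨?_, ?_⟩, ?_, ?_⟩
    · intro d d' hd
      have := (hF _ _ _ _ _ _).2 hd
      rwa [hp, hp] at this
    · intro d
      obtain ⟨x, y, k, rfl⟩ := hs d
      exact ⟨g.D x y k, key x y k⟩
    · intro d
      obtain ⟨x, y, k, rfl⟩ := g.surj d
      change F _ _ _ = H.rev (F _ _ _)
      simp only [key, hv, g.rev_D]
    · refine hr.imp (fun hr d => ?_) fun hr d => ?_ <;> obtain ⟨x, y, k, rfl⟩ := g.surj d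
      · change F _ _ _ = H.rot (F _ _ _)
        simp only [key, hr, g.rot_D]
      · change F _ _ _ = H.rot⁻¹ (F _ _ _)
        simp only [key, hr, g.rot_D]
  rcases hε with rfl | rfl
  · simp only [one_mul] at h
    exact ⟨g'.D, fun x y k x' y' k' => by simp only [eq_iff, h], g'.surj, g'.rev_D,
      .inl g'.rot_D⟩
  -- Reflection in the line `x = 1/2`, which passes through the centre `(1/2, 1/2)`; on directions
  -- it is `k ↦ 2 - k`.
  · refine ⟨fun x y k => g'.D (1 - x) y (2 - k), fun x y k x' y' k' => ?_, fun d => ?_,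
      fun x y k => ?_, .inr fun x y k => ?_⟩
    · rw [g.eq_iff, g'.eq_iff]
      refine or_congr (and_congr ?_ ?_) (and_congr ?_ ?_)
      · simp
      · constructor
        · rintro ⟨a, b, h', h1, h2⟩
          exact ⟨-1 * a, b, (h _ _).1 h', by omega, h2⟩
        · rintro ⟨a, b, h', h1, h2⟩
          exact ⟨-a, b, (h _ _).2 (by simpa using h'), by omega, h2⟩
      · revert k k'; decide
      · constructor
        · rintro ⟨a, b, h', h1, h2⟩
          exact ⟨-1 * a, b, (h _ _).1 h', by omega, h2⟩
        · rintro ⟨a, b, h', h1, h2⟩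
          exact ⟨-a, b, (h _ _).2 (by simpa using h'), by omega, h2⟩
    · obtain ⟨x, y, k, rfl⟩ := g'.surj d
      exact ⟨1 - x, y, 2 - k, by simp⟩
    · rw [g'.rev_D, dirX_sub, dirY_sub]
      congr 1
      · ring
      · revert k; decide
    · rw [g'.rot_inv_D]
      congr 1; ring

/-- A grid of an isomorphic map. -/
theorem exists_of_iso {H : FourValentMap} (g : H.Grid) (h : G.Iso H) :
    ∃ (g' : G.Grid) (ε : ℤ), (ε = 1 ∨ ε = -1) ∧ ∀ a b, (a, b) ∈ g'.L ↔ (ε * a, b) ∈ g.L := by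
  obtain ⟨e, hv, hr | hr⟩ := h
  · have hv' (d) : G.rev (e.symm d) = e.symm (H.rev d) := by
      rw [Equiv.eq_symm_apply, hv, e.apply_symm_apply]
    have hr' (d) : G.rot (e.symm d) = e.symm (H.rot d) := by
      rw [Equiv.eq_symm_apply, hr, e.apply_symm_apply]
    refine ⟨⟨⟨fun x y k => e.symm (g.D x y k), fun x y k => by rw [hr', g.rot_D],
      fun x y k => by rw [hv', g.rev_D], fun d => ?_⟩, g.L, congrArg e.symm g.half,
      fun x y x' y' => by simp only [e.symm.injective.eq_iff, g.zero_iff],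
      fun x y x' y' => by simp only [Ne, e.symm.injective.eq_iff, g.ne_one, not_false_iff]⟩,
      1, .inl rfl, by simp⟩
    obtain ⟨x, y, k, h⟩ := g.surj (e d)
    exact ⟨x, y, k, by rw [h, e.symm_apply_apply]⟩
  · have hv' (d) : G.rev (e.symm d) = e.symm (H.rev d) := by
      rw [Equiv.eq_symm_apply, hv, e.apply_symm_apply]
    have hr' (d) : G.rot (e.symm d) = e.symm (H.rot⁻¹ d) := by
      rw [Equiv.eq_symm_apply, hr, e.apply_symm_apply]
    refine ⟨⟨⟨fun x y k => e.symm (g.D (1 - x) y (2 - k)), fun x y k => ?_,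
      fun x y k => ?_, fun d => ?_⟩,
      { carrier := {p | (-p.1, p.2) ∈ g.L}
        zero_mem' := g.L.zero_mem
        add_mem' := by
          rintro ⟨a, b⟩ ⟨a', b'⟩ h h'
          have := g.L.add_mem h h'
          simpa [add_comm] using this
        neg_mem' := by
          rintro ⟨a, b⟩ h
          simpa using g.L.neg_mem h }, ?_, fun x y x' y' => ?_, fun x y x' y' => ?_⟩,
      -1, .inr rfl, fun a b => ?_⟩
    · rw [hr', g.rot_inv_D]
      congr 2; ring
    · rw [hv', g.rev_D, dirX_sub, dirY_sub]
      congr 2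
      · ring
      · revert k; decide
    · obtain ⟨x, y, k, h⟩ := g.surj (e d)
      exact ⟨1 - x, y, 2 - k, by simp [h]⟩
    · have := g.half_turn 1 0 2
      simpa [show (2 + 2 : ZMod 4) = 0 by decide] using this
    · rw [e.symm.injective.eq_iff, sub_zero, show (2 : ZMod 4) = 0 + 2 by decide,
        g.D_add_right_iff, g.zero_iff]
      constructor
      · rintro ⟨a, b, h', h1, h2⟩
        exact ⟨-a, b, by simpa using h', by omega, h2⟩
      · rintro ⟨a, b, h', h1, h2⟩
        exact ⟨-a, b, h', by omega, h2⟩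
    · rw [Ne, e.symm.injective.eq_iff, sub_zero, show (2 : ZMod 4) = 1 + 1 by decide,
        show (1 + 1 - 1 : ZMod 4) = 0 + 1 by decide, g.D_add_right_iff]
      exact fun h' => g.ne_one _ _ _ _ h'.symm
    · show (-a, b) ∈ g.L ↔ _
      rw [neg_one_mul]

/-- Pigeonhole: infinitely many points on a line, finitely many darts. With its analogue in the
other direction, this makes `L` a lattice of finite index. -/
theorem exists_pos_mem (g : G.Grid) : ∃ N : ℤ, 0 < N ∧ (N, 0) ∈ g.L := by
  obtain ⟨i, j, hij, h⟩ := Finite.exists_ne_map_eq_of_infinite fun i : ℤ => g.D i 0 0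
  obtain ⟨a, b, hab, h1, h2⟩ := (g.zero_iff _ _ _ _).1 h
  obtain rfl : b = 0 := by omega
  rcases lt_or_gt_of_ne (show a ≠ 0 by omega) with ha | ha
  · exact ⟨-a, by omega, by simpa using g.L.neg_mem hab⟩
  · exact ⟨a, ha, hab⟩

end Grid

end FourValentMap

/-! ### Central circuits as images of grid lines -/

namespace FourValentMap

theorem circuitOf_next (G : FourValentMap) (d : G.Dart) :
    G.circuitOf (G.next d) = G.circuitOf d := by
  rw [← G.circuitOf_rev d, ← G.circuitOf_rot_rot (G.rev d)]; rfl

theorem circuitOf_next_zpow (G : FourValentMap) (j : ℤ) (d : G.Dart) :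
    G.circuitOf ((G.next ^ j) d) = G.circuitOf d := by
  induction j using Int.induction_on with
  | zero => rfl
  | succ j ih => rw [add_comm, zpow_add, Equiv.Perm.mul_apply, zpow_one, circuitOf_next, ih]
  | pred j ih =>
    rw [← circuitOf_next, ← Equiv.Perm.mul_apply, ← zpow_one_add, add_sub_cancel, ih]

theorem rev_next_zpow (G : FourValentMap) (j : ℤ) (d : G.Dart) :
    G.rev ((G.next ^ j) d) = (G.next ^ (-j)) (G.rev d) := by
  have h1 : SemiconjBy G.rev G.next G.next⁻¹ := by
    refine Equiv.ext fun d => ?_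
    change G.rev (G.next d) = G.next⁻¹ (G.rev d)
    rw [eq_comm, Equiv.Perm.inv_eq_iff_eq]
    change _ = G.rot (G.rot (G.rev (G.rev (G.rot (G.rot (G.rev d))))))
    rw [G.rev_rev, G.rot_four]
  have := (h1.zpow_right j).eq
  rw [zpow_neg, ← inv_zpow]
  exact Equiv.congr_fun this d

/-- A central circuit is run through by repeated passages to the opposite dart. -/
theorem circuitOf_eq_iff (G : FourValentMap) (d d' : G.Dart) : G.circuitOf d = G.circuitOf d' ↔
    ∃ j : ℤ, (G.next ^ j) d = d' ∨ (G.next ^ j) (G.rev d) = d' := by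
  constructor
  · intro h
    obtain ⟨⟨f, hf⟩, hfd⟩ := Quotient.exact h.symm
    change f d = d' at hfd
    rw [← hfd]
    clear hfd h
    induction hf using Subgroup.closure_induction generalizing d with
    | mem f hf =>
      rcases hf with rfl | rfl
      · exact ⟨1, .inr (by simp [next, G.rev_rev])⟩
      · exact ⟨0, .inr rfl⟩
    | one => exact ⟨0, .inl rfl⟩
    | mul f f' _ _ h h' =>
      obtain ⟨i, hi⟩ := h' d
      obtain ⟨j, hj⟩ := h (f' d)
      rw [Equiv.Perm.mul_apply]
      rcases hi with hi | hi <;> rcases hj with hj | hj <;> rw [← hi] at hj ⊢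
      · exact ⟨j + i, .inl (by rw [← hj, zpow_add]; rfl)⟩
      · exact ⟨j - i, .inr (by rw [← hj, rev_next_zpow, sub_eq_add_neg, zpow_add]; rfl)⟩
      · exact ⟨j + i, .inr (by rw [← hj, zpow_add]; rfl)⟩
      · exact ⟨j - i, .inl (by
          rw [← hj, rev_next_zpow, sub_eq_add_neg, zpow_add, G.rev_rev]; rfl)⟩
    | inv f _ h =>
      obtain ⟨j, hj⟩ := h (f⁻¹ d)
      rw [show f (f⁻¹ d) = d from f.apply_symm_apply d] at hj
      rcases hj with hj | hj
      · exact ⟨-j, .inl (by rw [zpow_neg, Equiv.Perm.inv_eq_iff_eq, hj])⟩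
      · refine ⟨j, .inr ?_⟩
        rw [← congrArg G.rev hj, rev_next_zpow, G.rev_rev]; simp
  · rintro ⟨j, rfl | rfl⟩
    · rw [circuitOf_next_zpow]
    · rw [circuitOf_next_zpow, circuitOf_rev]

theorem vertexOf_eq_iff (G : FourValentMap) (d d' : G.Dart) : G.vertexOf d = G.vertexOf d' ↔
    ∃ n : ℕ, (G.rot ^ n) d = d' := by
  constructor
  · intro h
    exact (Quotient.exact h : Equiv.Perm.SameCycle G.rot d d').exists_nat_pow_eq
  · rintro ⟨n, h⟩
    exact Quotient.sound ⟨n, by simpa using h⟩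

theorem edgeOf_eq_iff (G : FourValentMap) (d d' : G.Dart) : G.edgeOf d = G.edgeOf d' ↔
    d = d' ∨ G.rev d = d' := by
  constructor
  · intro h
    obtain ⟨n, hn⟩ := (Quotient.exact h : Equiv.Perm.SameCycle G.rev d d').exists_nat_pow_eq
    have h2 : G.rev ^ 2 = 1 := Equiv.ext fun d => G.rev_rev d
    obtain ⟨m, rfl | rfl⟩ := Nat.even_or_odd' n
    · left; rw [← hn, pow_mul, h2]; simp
    · right; rw [← hn, pow_succ, pow_mul, h2]; simp
  · rintro (rfl | h)
    · rfl
    · exact Quotient.sound ⟨1, by simpa using h⟩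

namespace Grid

variable {G : FourValentMap} (g : G.Grid)

/-- The central circuit covered by the horizontal line through `(0, y)`. -/
def hor (y : ℤ) : G.CentralCircuit := G.circuitOf (g.D 0 y 0)

/-- The central circuit covered by the vertical line through `(x, 0)`. -/
def ver (x : ℤ) : G.CentralCircuit := G.circuitOf (g.D x 0 1)

theorem hor_eq_circuitOf_iff (y : ℤ) (d : G.Dart) : g.hor y = G.circuitOf d ↔
    ∃ j, d = g.D j y 0 ∨ d = g.D j y 2 := by
  rw [hor, circuitOf_eq_iff]
  simp only [g.rev_D, g.next_zpow_D]
  constructor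
  · rintro ⟨j, rfl | rfl⟩
    · exact ⟨j, .inl (by simp)⟩
    · exact ⟨1 - j, .inr (by simp [sub_eq_add_neg])⟩
  · rintro ⟨j, rfl | rfl⟩
    · exact ⟨j, .inl (by simp)⟩
    · exact ⟨1 - j, .inr (by simp)⟩

theorem ver_eq_circuitOf_iff (x : ℤ) (d : G.Dart) : g.ver x = G.circuitOf d ↔
    ∃ j, d = g.D x j 1 ∨ d = g.D x j 3 := by
  rw [ver, circuitOf_eq_iff]
  simp only [g.rev_D, g.next_zpow_D, show (1 + 2 : ZMod 4) = 3 by decide]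
  constructor
  · rintro ⟨j, rfl | rfl⟩
    · exact ⟨j, .inl (by simp)⟩
    · exact ⟨1 - j, .inr (by simp [sub_eq_add_neg])⟩
  · rintro ⟨j, rfl | rfl⟩
    · exact ⟨j, .inl (by simp)⟩
    · exact ⟨1 - j, .inr (by simp)⟩

theorem circuitOf_zero (x y : ℤ) : G.circuitOf (g.D x y 0) = g.hor y :=
  ((g.hor_eq_circuitOf_iff _ _).2 ⟨x, .inl rfl⟩).symm

theorem circuitOf_two (x y : ℤ) : G.circuitOf (g.D x y 2) = g.hor y :=
  ((g.hor_eq_circuitOf_iff _ _).2 ⟨x, .inr rfl⟩).symm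

theorem circuitOf_one (x y : ℤ) : G.circuitOf (g.D x y 1) = g.ver x :=
  ((g.ver_eq_circuitOf_iff _ _).2 ⟨y, .inl rfl⟩).symm

theorem circuitOf_three (x y : ℤ) : G.circuitOf (g.D x y 3) = g.ver x :=
  ((g.ver_eq_circuitOf_iff _ _).2 ⟨y, .inr rfl⟩).symm

theorem hor_ne_ver (x y : ℤ) : g.hor y ≠ g.ver x := by
  rw [ver, Ne, hor_eq_circuitOf_iff]
  simp [g.eq_iff, show (0 : ZMod 4) ≠ 1 by decide, show (2 : ZMod 4) ≠ 1 by decide,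
    show (0 : ZMod 4) ≠ 1 + 2 by decide, show (2 : ZMod 4) ≠ 1 + 2 by decide]

/-- Translations move the line by `2 b`; half turns also reflect it in `y = 1/2`. In particular the
lines `0` and `1` always cover the same circuit. -/
theorem hor_eq_iff (y y' : ℤ) : g.hor y = g.hor y' ↔
    ∃ a b, (a, b) ∈ g.L ∧ (y' = y + 2 * b ∨ 1 - y' = y + 2 * b) := by
  change g.hor y = G.circuitOf _ ↔ _
  rw [hor_eq_circuitOf_iff]
  simp only [g.eq_iff, show (0 : ZMod 4) ≠ 2 by decide, show (2 : ZMod 4) ≠ 0 by decide,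
    true_and, false_and, or_false, false_or, zero_add]
  constructor
  · rintro ⟨j, ⟨a, b, h, h1, h2⟩ | ⟨a, b, h, h1, h2⟩⟩
    · exact ⟨-a, -b, g.L.neg_mem h, .inl (by omega)⟩
    · exact ⟨a, b, h, .inr (by omega)⟩
  · rintro ⟨a, b, h, h1 | h1⟩
    · exact ⟨-2 * a, .inl ⟨-a, -b, g.L.neg_mem h, by omega, by omega⟩⟩
    · exact ⟨1 - 2 * a, .inr ⟨a, b, h, by omega, by omega⟩⟩

theorem turn_hor (y : ℤ) : g.turn.hor y = g.ver (1 - y) := g.circuitOf_one _ _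

theorem ver_eq_iff (x x' : ℤ) : g.ver x = g.ver x' ↔
    ∃ a b, (a, b) ∈ g.L ∧ (x' = x + 2 * a ∨ 1 - x' = x + 2 * a) := by
  have := g.turn.hor_eq_iff (1 - x) (1 - x')
  rw [turn_hor, turn_hor, sub_sub_cancel, sub_sub_cancel] at this
  rw [this]
  constructor
  · rintro ⟨a, b, h, h1⟩
    exact ⟨-b, a, h, by omega⟩
  · rintro ⟨a, b, h, h1⟩
    exact ⟨b, -a, by simpa [mem_turn] using h, by omega⟩

theorem circuit_cases (g : G.Grid) (C : G.CentralCircuit) :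
    (∃ y, C = g.hor y) ∨ ∃ x, C = g.ver x := by
  obtain ⟨d, rfl⟩ := Quotient.exists_rep C
  change (∃ y, G.circuitOf d = _) ∨ ∃ x, G.circuitOf d = _
  obtain ⟨x, y, k, rfl⟩ := g.surj d
  have hk : k = 0 ∨ k = 1 ∨ k = 2 ∨ k = 3 := by revert k; decide
  rcases hk with rfl | rfl | rfl | rfl
  · exact .inl ⟨y, g.circuitOf_zero x y⟩
  · exact .inr ⟨x, g.circuitOf_one x y⟩
  · exact .inl ⟨y, g.circuitOf_two x y⟩
  · exact .inr ⟨x, g.circuitOf_three x y⟩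

/-- Both projections of the lattice are surjective. -/
def IsFull : Prop := (∃ a, (a, 1) ∈ g.L) ∧ ∃ b, (1, b) ∈ g.L

variable {g}

theorem hor_eq_of_mem {a : ℤ} (h : (a, 1) ∈ g.L) (y y' : ℤ) : g.hor y = g.hor y' := by
  rw [hor_eq_iff]
  obtain ⟨c, hc⟩ := Int.even_or_odd' (y' - y)
  rcases hc with hc | hc
  · exact ⟨c * a, c, by simpa using g.L.zsmul_mem h c, .inl (by omega)⟩
  · exact ⟨(-y - c) * a, -y - c, by simpa using g.L.zsmul_mem h (-y - c), .inr (by omega)⟩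

theorem IsFull.turn (h : g.IsFull) : g.turn.IsFull := by
  obtain ⟨⟨a, ha⟩, ⟨b, hb⟩⟩ := h
  exact ⟨⟨-b, by simpa [mem_turn] using g.L.neg_mem hb⟩, ⟨-a, by simpa [mem_turn] using ha⟩⟩

theorem IsFull.hor_eq (h : g.IsFull) (y y' : ℤ) : g.hor y = g.hor y' :=
  h.1.elim fun _ ha => hor_eq_of_mem ha y y'

theorem IsFull.ver_eq (h : g.IsFull) (x x' : ℤ) : g.ver x = g.ver x' := by
  have := h.turn.hor_eq (1 - x) (1 - x')
  simpa only [turn_hor, sub_sub_cancel] using this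

theorem card_circuit_eq_two_iff (g : G.Grid) : Nat.card G.CentralCircuit = 2 ↔ g.IsFull := by
  constructor
  · intro h
    obtain ⟨C, hC, hu⟩ := (Nat.card_eq_two_iff' (g.ver 0)).1 h
    obtain ⟨D, hD, hv⟩ := (Nat.card_eq_two_iff' (g.hor 0)).1 h
    constructor
    -- Lines `1` and `2` have different parity, so only a half turn can identify them, and then `b =
    -- -1`.
    · obtain ⟨a, b, hab, h1⟩ := (g.hor_eq_iff 1 2).1
        ((hu _ (g.hor_ne_ver _ _)).trans (hu _ (g.hor_ne_ver _ _)).symm)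
      rcases h1 with h1 | h1
      · omega
      · exact ⟨-a, by
          obtain rfl : b = -1 := by omega
          simpa using g.L.neg_mem hab⟩
    · obtain ⟨a, b, hab, h1⟩ := (g.ver_eq_iff 1 2).1
        ((hv _ (g.hor_ne_ver _ _).symm).trans (hv _ (g.hor_ne_ver _ _).symm).symm)
      rcases h1 with h1 | h1
      · omega
      · exact ⟨-b, by
          obtain rfl : a = -1 := by omega
          simpa using g.L.neg_mem hab⟩
  · intro h
    refine (Nat.card_eq_two_iff' (g.ver 0)).2 ⟨g.hor 0, g.hor_ne_ver _ _, fun C hC => ?_⟩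
    rcases g.circuit_cases C with ⟨y, rfl⟩ | ⟨x, rfl⟩
    · exact h.hor_eq _ _
    · exact (hC (h.ver_eq _ _)).elim

/-- Any circuit of a map with two central circuits is horizontal in a suitable grid. -/
theorem IsFull.exists_hor (h : g.IsFull) (C : G.CentralCircuit) :
    ∃ g' : G.Grid, g'.IsFull ∧ C = g'.hor 0 := by
  rcases g.circuit_cases C with ⟨y, rfl⟩ | ⟨x, rfl⟩
  · exact ⟨g, h, h.hor_eq _ _⟩
  · exact ⟨g.turn, h.turn, by rw [turn_hor]; exact h.ver_eq _ _⟩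

/-- The edge at `(x, y)` in direction `0` has a digon on its left when `(x, y) ∈ L` and on its right
when `(x, y - 1) ∈ L`. Passing `j` vertices from one kind to the other therefore exhibits `(j, 1)`
or `(j, -1)` as a difference of lattice points. Half turns preserve sides, so direction `0`
suffices. -/
theorem IsFull.isShift_iff (h : g.IsFull) (j : ℕ) :
    G.IsShift (g.hor 0) j ↔ ((j : ℤ), 1) ∈ g.L ∨ ((j : ℤ), -1) ∈ g.L := by
  have hn (x y : ℤ) : (G.next ^ j) (g.D x y 0) = g.D (x + j) y 0 := by
    simpa using g.next_zpow_D x y 0 j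
  have hr (x y : ℤ) : G.IsGon 2 (G.rightFace (g.D x y 0)) ↔ (x, y - 1) ∈ g.L := by
    rw [rightFace_zero, isGon_two_iff, ← neg_mem_iff]
    simp
  constructor
  · rintro ⟨d, hd, hs⟩
    obtain ⟨x, y, rfl⟩ : ∃ x y, d = g.D x y 0 := by
      obtain ⟨x, h | h⟩ := (g.hor_eq_circuitOf_iff _ _).1 hd.symm
      · exact ⟨_, _, h⟩
      · exact ⟨_, _, h.trans (g.half_turn _ _ _)⟩
    rw [hn, isGon_two_iff, isGon_two_iff, hr, hr] at hs
    rcases hs with hs | hs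
    · have := g.L.sub_mem hs.2 hs.1
      rw [Prod.mk_sub_mk, add_sub_cancel_left, sub_sub_cancel_left] at this
      exact .inr this
    · have := g.L.sub_mem hs.2 hs.1
      rw [Prod.mk_sub_mk, add_sub_cancel_left, sub_sub_cancel] at this
      exact .inl this
  · rintro (hj | hj)
    · exact ⟨g.D 0 1 0, h.hor_eq _ _, .inr ⟨(hr _ _).2 g.L.zero_mem, by
        rw [hn, isGon_two_iff]; simpa using hj⟩⟩
    · exact ⟨g.D 0 0 0, rfl, .inl ⟨(g.isGon_two_iff _ _).2 g.L.zero_mem, by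
        rw [hn, hr]; simpa using hj⟩⟩

end Grid

end FourValentMap

/-! ### Normal form of lattices; rail-roads, lengths and intersections -/

namespace FourValentMap

theorem exists_dvd_of_subgroup (H : AddSubgroup ℤ) {N : ℤ} (hN : 0 < N) (h : N ∈ H) :
    ∃ n : ℕ, 0 < n ∧ ∀ x, x ∈ H ↔ (n : ℤ) ∣ x := by
  obtain ⟨a, rfl⟩ := Int.subgroup_cyclic H
  rw [← AddSubgroup.zmultiples_eq_closure] at h ⊢
  simp only [Int.mem_zmultiples_iff] at h ⊢
  refine ⟨a.natAbs, ?_, fun x => by rw [Int.natCast_natAbs, abs_dvd]⟩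
  rw [Int.natAbs_pos]
  rintro rfl
  rw [zero_dvd_iff] at h
  omega

/-- A normal form for the sublattices of finite index of `ℤ × ℤ`. -/
theorem exists_normal_form (L : AddSubgroup (ℤ × ℤ)) {M N : ℤ} (hM : 0 < M) (hN : 0 < N)
    (hML : (M, 0) ∈ L) (hNL : (0, N) ∈ L) :
    ∃ (v h u : ℕ) (s : ℤ), 0 < v ∧ 0 < h ∧ 0 < u ∧ IsCoprime (u : ℤ) s ∧
      ∀ x y, (x, y) ∈ L ↔ ∃ i j : ℤ, x = v * (u * i + s * j) ∧ y = h * j := by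
  obtain ⟨h, h0, hh⟩ := exists_dvd_of_subgroup (L.map (AddMonoidHom.snd ℤ ℤ)) hN ⟨_, hNL, rfl⟩
  obtain ⟨w, w0, hw⟩ := exists_dvd_of_subgroup (L.comap (AddMonoidHom.inl ℤ ℤ)) hM hML
  change ∀ x, (x, 0) ∈ L ↔ _ at hw
  obtain ⟨⟨t, h'⟩, ht, hth⟩ := (hh h).2 dvd_rfl
  obtain rfl : h' = h := hth
  -- `L` has the basis `(w, 0)`, `(t, h)`. Hence `gcd w t` generates its projection to the first
  -- axis, and dividing it out leaves the coprime pair `u`, `s`.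
  have hv : 0 < Int.gcd w t := Int.gcd_pos_of_ne_zero_left _ (by omega)
  obtain ⟨u, s, hc, hu, hs⟩ := Int.exists_gcd_one hv
  have hu0 : 0 < u := by
    by_contra hu0
    have : (w : ℤ) ≤ 0 := by
      rw [hu]; exact mul_nonpos_of_nonpos_of_nonneg (by omega) (by positivity)
    omega
  lift u to ℕ using hu0.le
  refine ⟨Int.gcd w t, h, u, s, hv, h0, by omega, Int.isCoprime_iff_gcd_eq_one.2 hc,
    fun x y => ?_⟩
  have hwi (i : ℤ) : (w * i, 0) ∈ L := (hw _).2 (dvd_mul_right _ _)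
  have htj (j : ℤ) : (j * t, j * h) ∈ L := by simpa using L.zsmul_mem ht j
  have he (i j : ℤ) : (Int.gcd w t : ℤ) * (u * i + s * j) = w * i + j * t := by
    linear_combination (-i) * hu - j * hs
  simp only [he]
  constructor
  · intro hxy
    obtain ⟨j, rfl⟩ := (hh y).1 ⟨_, hxy, rfl⟩
    have := L.sub_mem hxy (htj j)
    rw [Prod.mk_sub_mk, mul_comm (h : ℤ), sub_self, hw] at this
    obtain ⟨i, hi⟩ := this
    exact ⟨i, j, by rw [← hi]; ring, rfl⟩
  · rintro ⟨i, j, rfl, rfl⟩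
    have := L.add_mem (hwi i) (htj j)
    rwa [Prod.mk_add_mk, zero_add, mul_comm j (h : ℤ)] at this

/-- Counting the part of the image of a periodic sequence in which a predicate holds. -/
theorem card_of_periodic {α : Type*} {A B : α → Prop} (f : ℤ → α) (n : ℕ)
    (hA : ∀ a, A a ↔ ∃ i, a = f i) (hf : ∀ i j, f i = f j ↔ (n : ℤ) ∣ j - i) :
    Nat.card {a // A a ∧ B a} = Nat.card {z : ZMod n // B (f z.cast)} := by
  refine (Nat.card_congr (Equiv.ofBijective
    (fun z : {z : ZMod n // B (f z.cast)} => (⟨f z.1.cast, (hA _).2 ⟨_, rfl⟩, z.2⟩ :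
      {a // A a ∧ B a})) ⟨?_, ?_⟩)).symm
  · rintro ⟨z, hz⟩ ⟨z', hz'⟩ h
    have h1 := (hf _ _).1 (congrArg Subtype.val h)
    rw [← ZMod.intCast_eq_intCast_iff_dvd_sub] at h1
    simpa using h1
  · rintro ⟨a, ha, hb⟩
    obtain ⟨i, rfl⟩ := (hA a).1 ha
    have : f ((i : ZMod n).cast) = f i := by
      rw [hf, ← ZMod.intCast_eq_intCast_iff_dvd_sub]; simp
    exact ⟨⟨i, by rwa [this]⟩, Subtype.ext this⟩

theorem card_of_periodic' {α : Type*} {A : α → Prop} (f : ℤ → α) (n : ℕ)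
    (hA : ∀ a, A a ↔ ∃ i, a = f i) (hf : ∀ i j, f i = f j ↔ (n : ℤ) ∣ j - i) :
    Nat.card {a // A a} = n := by
  have := card_of_periodic (B := fun _ => True) f n hA hf
  rw [← Nat.card_zmod n, ← Nat.card_congr (Equiv.subtypeUnivEquiv (p := fun _ : ZMod n => True)
    fun _ => trivial), ← this]
  simp

theorem two_mul_dvd_sub_one (v : ℕ) (x : ℤ) : ¬ ((2 * v : ℕ) : ℤ) ∣ 2 * x - 1 := by
  rintro ⟨c, hc⟩
  push_cast at hc
  have : 2 * x - 1 = 2 * (v * c) := by rw [hc]; ring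
  omega

/-- The two residue classes of `x` and `1 - x` modulo `2 v` take a part of `ZMod (2 w)` which does
not depend on `x`. -/
theorem card_residues {v w : ℕ} (hw : 0 < w) (hvw : v ∣ w) (x x' : ℤ) :
    Nat.card {z : ZMod (2 * w) // ((2 * v : ℕ) : ℤ) ∣ x - z.cast ∨
      ((2 * v : ℕ) : ℤ) ∣ x + z.cast - 1} =
    Nat.card {z : ZMod (2 * w) // ((2 * v : ℕ) : ℤ) ∣ x' - z.cast ∨
      ((2 * v : ℕ) : ℤ) ∣ x' + z.cast - 1} := by
  have : NeZero (2 * w) := ⟨by omega⟩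
  let c := ZMod.castHom (Nat.mul_dvd_mul_left 2 hvw) (ZMod (2 * v))
  have h1 (x : ℤ) (z : ZMod (2 * w)) : ((2 * v : ℕ) : ℤ) ∣ x - z.cast ↔ c z = x := by
    rw [← ZMod.intCast_eq_intCast_iff_dvd_sub]; simp [c]
  have h2 (x : ℤ) (z : ZMod (2 * w)) : ((2 * v : ℕ) : ℤ) ∣ x + z.cast - 1 ↔ c z = 1 - x := by
    rw [show x + (z.cast : ℤ) - 1 = z.cast - (1 - x) by ring,
      ← ZMod.intCast_eq_intCast_iff_dvd_sub, eq_comm]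
    simp [c]
  have h3 (x : ℤ) : (x : ZMod (2 * v)) ≠ 1 - x := by
    intro h
    apply two_mul_dvd_sub_one v x
    rw [show 2 * x - 1 = x - (1 - x) by ring, ← ZMod.intCast_eq_intCast_iff_dvd_sub]
    push_cast
    exact h.symm
  simp only [h1, h2]
  have key (x x' : ℤ) : Nat.card {z : ZMod (2 * w) // c z = x ∨ c z = 1 - x} ≤
      Nat.card {z : ZMod (2 * w) // c z = x' ∨ c z = 1 - x'} := by
    classical
    have hc (x : ℤ) : c (x : ZMod (2 * w)) = x := by simp [c]
    -- The class of `x` is translated by `x' - x` and that of `1 - x` backwards by the same amount;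
    -- the two classes are disjoint because `2 x - 1` is odd.
    let f : ZMod (2 * w) → ZMod (2 * w) := fun z =>
      if c z = x then z + ((x' - x : ℤ)) else z - ((x' - x : ℤ))
    have hf1 (z) (h : c z = x) : c (f z) = x' := by
      simp only [f, if_pos h, map_add, hc, h]; push_cast; ring
    have hf2 (z) (h : c z = 1 - x) : c (f z) = 1 - x' := by
      have : c z ≠ x := fun h' => h3 x (h'.symm.trans h)
      simp only [f, if_neg this, map_sub, hc, h]; push_cast; ring
    refine Nat.card_le_card_of_injective
      (fun z => ⟨f z.1, z.2.imp (hf1 _) (hf2 _)⟩) ?_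
    rintro ⟨z, hz⟩ ⟨z', hz'⟩ hzz
    have h : f z = f z' := congrArg Subtype.val hzz
    clear hzz
    have hn (z) (h : c z = 1 - x) : c z ≠ x := fun h' => h3 x (h'.symm.trans h)
    rcases hz with hz | hz <;> rcases hz' with hz' | hz'
    · simpa [f, hz, hz'] using h
    · exact (h3 x' ((hf1 _ hz).symm.trans ((congrArg c h).trans (hf2 _ hz')))).elim
    · exact (h3 x' ((hf1 _ hz').symm.trans ((congrArg c h.symm).trans (hf2 _ hz)))).elim
    · simp only [f, if_neg (hn z hz), if_neg (hn z' hz')] at h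
      simpa using h
  exact le_antisymm (key _ _) (key _ _)

namespace Grid

variable {G : FourValentMap} {g : G.Grid}

/-- Crossing a square to the opposite side displaces the dart to its left without turning it, so
rail-roads lift to straight rows or columns of squares. -/
theorem rev_face_face_D (g : G.Grid) (x y : ℤ) (k : ZMod 4) :
    G.rev (G.face (G.face (g.D x y k))) = g.D (x + dirX (k + 1)) (y + dirY (k + 1)) k := by
  rw [g.face_D, g.face_D, g.rev_D]
  simp only [dirX_add_one, dirY_add_one]
  congr 1
  · ring
  · ring
  · revert k; decide

theorem exists_pos_mem' (g : G.Grid) : ∃ N : ℤ, 0 < N ∧ (0, N) ∈ g.L := by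
  obtain ⟨N, hN, h⟩ := g.turn.exists_pos_mem
  exact ⟨N, hN, by simpa [mem_turn] using h⟩

theorem exists_normal_form (g : G.Grid) :
    ∃ (v h u : ℕ) (s : ℤ), 0 < v ∧ 0 < h ∧ 0 < u ∧ IsCoprime (u : ℤ) s ∧
      ∀ x y, (x, y) ∈ g.L ↔ ∃ i j : ℤ, x = v * (u * i + s * j) ∧ y = h * j := by
  obtain ⟨M, hM, hML⟩ := g.exists_pos_mem
  obtain ⟨N, hN, hNL⟩ := g.exists_pos_mem'
  exact FourValentMap.exists_normal_form g.L hM hN hML hNL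

/-- In an irreducible map, every vertical strip of the grid contains a digon. -/
theorem exists_mem_of_isIrreducible (hG : G.IsIrreducible) : ∃ b, (1, b) ∈ g.L := by
  by_contra! hb
  obtain ⟨N, hN, hNL⟩ := g.exists_pos_mem'
  -- `(0, N) ∈ L` gives the translation by `2 N`, so the column of squares closes up after `2 N`
  -- steps.
  have hper (i : ℤ) : g.D 1 (((i : ZMod (2 * N).toNat).cast : ℤ)) 0 = g.D 1 i 0 := by
    rw [g.zero_iff]
    have : (((2 * N).toNat : ℕ) : ℤ) ∣ i - ((i : ZMod (2 * N).toNat).cast : ℤ) := by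
      rw [← ZMod.intCast_eq_intCast_iff_dvd_sub]; simp
    rw [Int.toNat_of_nonneg (by omega)] at this
    obtain ⟨c, hc⟩ := this
    refine ⟨0, c * N, by simpa using g.L.zsmul_mem hNL c, by omega, ?_⟩
    linear_combination hc
  refine hG ⟨(2 * N).toNat, fun i => g.D 1 i.cast 0, by omega, fun i => ?_⟩
  obtain ⟨i, rfl⟩ := ZMod.intCast_surjective i
  refine ⟨(g.isGon_four_iff _ _).2 (hb _), ?_⟩
  rw [show (i : ZMod (2 * N).toNat) + 1 = ((i + 1 : ℤ) : ZMod _) by push_cast; rfl]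
  simp only [hper, rev_face_face_D]
  simp

/-- A missing residue in a projection leaves a row or column without digons, which is a rail-road.
Conversely, a rail-road lifts to a whole row or column, and in a full lattice each of these contains
a digon. -/
theorem isIrreducible_iff (g : G.Grid) : G.IsIrreducible ↔ g.IsFull := by
  constructor
  · intro h
    obtain ⟨b, hb⟩ := exists_mem_of_isIrreducible (g := g.turn) h
    exact ⟨⟨-b, hb⟩, exists_mem_of_isIrreducible h⟩
  · rintro ⟨⟨a, ha⟩, ⟨b, hb⟩⟩ ⟨m, r, hm, hr⟩
    have key (x y : ℤ) (k : ZMod 4) (h0 : r 0 = g.D x y k) (j : ℤ) :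
        r (j : ZMod m) = g.D (x + j * dirX (k + 1)) (y + j * dirY (k + 1)) k := by
      induction j using Int.induction_on with
      | zero => simpa using h0
      | succ j ih =>
        rw [Int.cast_add, Int.cast_one, (hr _).2, ih, rev_face_face_D]
        congr 1 <;> ring
      | pred j ih =>
        have h1 := (hr ((-j - 1 : ℤ) : ZMod m)).2
        rw [show (((-j - 1 : ℤ) : ZMod m) + 1) = ((-j : ℤ) : ZMod m) by push_cast; ring, ih] at h1
        apply G.face.injective
        apply G.face.injective
        apply G.rev.injective
        rw [← h1, rev_face_face_D]
        congr 1 <;> ring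
    have h4 (j : ℤ) : G.face (G.face (r j)) ≠ r j :=
      (FourValentMap.isGon_four_iff g.face_four _).1 (hr _).1
    have h4' (j : ℤ) : ¬ G.IsGon 2 (G.leftFace (r j)) := by
      rw [FourValentMap.isGon_two_iff g.face_ne]; exact h4 j
    obtain ⟨x, y, k, hk, h0⟩ : ∃ x y k, (k = 0 ∨ k = 1) ∧ r 0 = g.D x y k := by
      obtain ⟨x, y, k, h0⟩ := g.surj (r 0)
      have hk : (k = 0 ∨ k = 1) ∨ (k + 2 = 0 ∨ k + 2 = 1) := by clear h0; revert k; decide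
      rcases hk with hk | hk
      · exact ⟨x, y, k, hk, h0.symm⟩
      · exact ⟨1 - x, 1 - y, k + 2, hk, by rw [← h0, g.half_turn]⟩
    rcases hk with rfl | rfl
    -- The multiple `x • (1, b)` of a lattice vector is a digon in column `x`, at height `x * b`.
    · refine h4' (x * b - y) ?_
      rw [key x y 0 h0, isGon_two_iff]
      simpa using g.L.zsmul_mem hb x
    · refine h4' (-(y * a - (x - 1))) ?_
      rw [key x y 1 h0, leftFace_one, isGon_two_iff]
      convert g.L.zsmul_mem ha y using 1
      simp only [show (1 + 1 : ZMod 4) = 2 by decide, dirX_two, dirY_two, Prod.smul_mk,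
        smul_eq_mul, mul_one, Prod.mk.injEq]
      constructor <;> ring

theorem vertexOf_D (g : G.Grid) (x y : ℤ) (k : ZMod 4) :
    G.vertexOf (g.D x y k) = G.vertexOf (g.D x y 0) := by
  rw [eq_comm, vertexOf_eq_iff]
  exact ⟨k.val, by rw [g.rot_pow_D]; simp⟩

theorem vertexOf_eq_iff' (x y : ℤ) (d : G.Dart) :
    G.vertexOf (g.D x y 0) = G.vertexOf d ↔ ∃ k, d = g.D x y k := by
  constructor
  · intro h
    obtain ⟨n, rfl⟩ := (vertexOf_eq_iff _ _ _).1 h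
    exact ⟨_, g.rot_pow_D _ _ _ _⟩
  · rintro ⟨k, rfl⟩
    exact (g.vertexOf_D _ _ _).symm

theorem exists_vertexOf (g : G.Grid) (v : G.Vertex) : ∃ x y, v = G.vertexOf (g.D x y 0) := by
  obtain ⟨d, rfl⟩ := Quotient.exists_rep v
  obtain ⟨x, y, k, rfl⟩ := g.surj d
  exact ⟨x, y, g.vertexOf_D x y k⟩

theorem circuitOf_even_or_odd (x y : ℤ) (k : ZMod 4) :
    G.circuitOf (g.D x y k) = g.hor y ∨ G.circuitOf (g.D x y k) = g.ver x := by
  have hk : k = 0 ∨ k = 1 ∨ k = 2 ∨ k = 3 := by revert k; decide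
  rcases hk with rfl | rfl | rfl | rfl
  · exact .inl (g.circuitOf_zero x y)
  · exact .inr (g.circuitOf_one x y)
  · exact .inl (g.circuitOf_two x y)
  · exact .inr (g.circuitOf_three x y)

/-- The circuits through a vertex. -/
theorem exists_circuitOf_iff (x y : ℤ) (C : G.CentralCircuit) :
    (∃ d, G.vertexOf d = G.vertexOf (g.D x y 0) ∧ G.circuitOf d = C) ↔
      C = g.hor y ∨ C = g.ver x := by
  constructor
  · rintro ⟨d, hd, rfl⟩
    obtain ⟨k, rfl⟩ := (vertexOf_eq_iff' x y d).1 hd.symm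
    exact circuitOf_even_or_odd x y k
  · rintro (rfl | rfl)
    · exact ⟨_, rfl, g.circuitOf_zero x y⟩
    · exact ⟨_, g.vertexOf_D x y 1, g.circuitOf_one x y⟩

/-- No half turn can map a row to itself, since `1 - y = y + 2 b` is impossible by parity. So only
the horizontal translations by `2 w` identify points of a row. -/
theorem vertexOf_row_eq_iff {w : ℕ} (hw : ∀ a, (a, 0) ∈ g.L ↔ (w : ℤ) ∣ a) (y i j : ℤ) :
    G.vertexOf (g.D i y 0) = G.vertexOf (g.D j y 0) ↔ ((2 * w : ℕ) : ℤ) ∣ j - i := by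
  rw [vertexOf_eq_iff']
  simp only [g.eq_iff]
  constructor
  · rintro ⟨k, ⟨-, a, b, h, h1, h2⟩ | ⟨-, a, b, h, h1, h2⟩⟩
    · obtain rfl : b = 0 := by omega
      obtain ⟨c, rfl⟩ := (hw a).1 h
      exact ⟨-c, by push_cast; linear_combination -h1⟩
    · omega
  · rintro ⟨c, hc⟩
    push_cast at hc
    exact ⟨0, .inl ⟨rfl, -(w * c), 0, (hw _).2 (by simp), by linear_combination -hc, by simp⟩⟩

theorem vertex_on_hor_iff (y : ℤ) (v : G.Vertex) :
    (∃ d, G.vertexOf d = v ∧ G.circuitOf d = g.hor y) ↔ ∃ i, v = G.vertexOf (g.D i y 0) := by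
  constructor
  · rintro ⟨d, rfl, h⟩
    obtain ⟨j, rfl | rfl⟩ := (g.hor_eq_circuitOf_iff _ _).1 h.symm
    · exact ⟨j, rfl⟩
    · exact ⟨j, g.vertexOf_D _ _ _⟩
  · rintro ⟨i, rfl⟩
    exact ⟨_, rfl, g.circuitOf_zero _ _⟩

/-- The length of a horizontal circuit. -/
theorem length_hor {w : ℕ} (hw : ∀ a, (a, 0) ∈ g.L ↔ (w : ℤ) ∣ a) (y : ℤ) :
    G.length (g.hor y) = 2 * w := by
  refine card_of_periodic' (fun i => G.edgeOf (g.D i y 0)) _ (fun e => ?_) fun i j => ?_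
  · constructor
    · rintro ⟨d, rfl, h⟩
      obtain ⟨j, rfl | rfl⟩ := (g.hor_eq_circuitOf_iff _ _).1 h.symm
      · exact ⟨j, rfl⟩
      · exact ⟨j - 1, by rw [edgeOf_eq_iff, g.rev_D]; right; simp [sub_eq_add_neg]; rfl⟩
    · rintro ⟨i, rfl⟩
      exact ⟨_, rfl, g.circuitOf_zero _ _⟩
  · rw [← vertexOf_row_eq_iff hw y]
    rw [edgeOf_eq_iff, vertexOf_eq_iff']
    constructor
    · rintro (h | h)
      · exact ⟨0, h.symm⟩
      · rw [g.rev_D, g.eq_iff] at h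
        rcases h with ⟨h, -⟩ | ⟨-, a, b, -, -, h⟩
        · exact absurd h (by decide)
        · simp only [dirY_zero] at h; omega
    · rintro ⟨k, h⟩
      obtain ⟨rfl, -⟩ | ⟨-, a, b, -, -, h⟩ := (g.eq_iff _ _ _ _ _ _).1 h
      · exact .inl h.symm
      · omega

/-- Every vertex lies on a horizontal circuit; when there is only one, a single period of a row
lists all vertices once. -/
theorem numVertices_eq {w : ℕ} (hw : ∀ a, (a, 0) ∈ g.L ↔ (w : ℤ) ∣ a)
    (h : ∀ y, g.hor y = g.hor 0) : G.numVertices = 2 * w := by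
  rw [numVertices, ← Nat.card_congr (Equiv.subtypeUnivEquiv (p := fun _ : G.Vertex => True)
    fun _ => trivial)]
  refine card_of_periodic' (fun i => G.vertexOf (g.D i 0 0)) _ (fun v => ?_)
    (vertexOf_row_eq_iff hw 0)
  rw [← vertex_on_hor_iff, true_iff]
  obtain ⟨x, y, rfl⟩ := g.exists_vertexOf v
  exact ⟨_, rfl, (g.circuitOf_zero _ _).trans (h y)⟩

theorem selfIntersections_eq_zero (g : G.Grid) (C : G.CentralCircuit) :
    G.selfIntersections C = 0 := by
  refine Finite.card_eq_zero_iff.2 ⟨fun ⟨v, hv⟩ => ?_⟩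
  obtain ⟨x, y, rfl⟩ := g.exists_vertexOf v
  exact g.hor_ne_ver x y (((g.circuitOf_zero _ _).symm.trans (hv _ rfl)).trans
    ((hv _ (g.vertexOf_D x y 1)).symm.trans (g.circuitOf_one _ _)))

theorem intersections_comm (C C' : G.CentralCircuit) :
    G.intersections C C' = G.intersections C' C :=
  Nat.card_congr (Equiv.subtypeEquivRight fun _ => and_comm)

theorem intersections_hor_hor {y y' : ℤ} (h : g.hor y ≠ g.hor y') :
    G.intersections (g.hor y) (g.hor y') = 0 := by
  refine Finite.card_eq_zero_iff.2 ⟨fun ⟨v, h1, h2⟩ => ?_⟩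
  obtain ⟨x, z, rfl⟩ := g.exists_vertexOf v
  rw [exists_circuitOf_iff, or_iff_left (g.hor_ne_ver _ _)] at h1 h2
  exact h (h1.trans h2.symm)

theorem intersections_ver_ver {x x' : ℤ} (h : g.ver x ≠ g.ver x') :
    G.intersections (g.ver x) (g.ver x') = 0 := by
  refine Finite.card_eq_zero_iff.2 ⟨fun ⟨v, h1, h2⟩ => ?_⟩
  obtain ⟨z, y, rfl⟩ := g.exists_vertexOf v
  rw [exists_circuitOf_iff, or_iff_right (g.hor_ne_ver _ _).symm] at h1 h2
  exact h (h1.trans h2.symm)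

/-- Vertices of a row correspond to residues modulo `2 w`. Those on the circuit of column `x` are
the residues congruent to `x` or `1 - x` modulo `2 v`, and `card_residues` shows that their number
is independent of `x`. -/
theorem intersections_hor_ver {v w : ℕ} (hw0 : 0 < w) (hvw : v ∣ w)
    (hw : ∀ a, (a, 0) ∈ g.L ↔ (w : ℤ) ∣ a) (hv : ∀ a, (∃ b, (a, b) ∈ g.L) ↔ (v : ℤ) ∣ a)
    (x y x' y' : ℤ) : G.intersections (g.hor y) (g.ver x) =
      G.intersections (g.hor y') (g.ver x') := by
  have hver (x z : ℤ) : g.ver x = g.ver z ↔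
      ((2 * v : ℕ) : ℤ) ∣ x - z ∨ ((2 * v : ℕ) : ℤ) ∣ x + z - 1 := by
    rw [ver_eq_iff]
    push_cast
    constructor
    · rintro ⟨a, b, h, h1 | h1⟩ <;> obtain ⟨c, rfl⟩ := (hv a).1 ⟨b, h⟩
      · exact .inl ⟨-c, by rw [h1]; ring⟩
      · exact .inr ⟨-c, by linear_combination -h1⟩
    · rintro (⟨c, hc⟩ | ⟨c, hc⟩) <;> obtain ⟨b, hb⟩ := (hv (v * -c)).2 (dvd_mul_right _ _)
      · exact ⟨_, b, hb, .inl (by linear_combination -hc)⟩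
      · exact ⟨_, b, hb, .inr (by linear_combination -hc)⟩
  have key (x y : ℤ) : G.intersections (g.hor y) (g.ver x) =
      Nat.card {z : ZMod (2 * w) // ((2 * v : ℕ) : ℤ) ∣ x - z.cast ∨
        ((2 * v : ℕ) : ℤ) ∣ x + z.cast - 1} := by
    rw [intersections, card_of_periodic (fun i => G.vertexOf (g.D i y 0)) (2 * w)
      (vertex_on_hor_iff y) (vertexOf_row_eq_iff hw y)]
    refine Nat.card_congr (Equiv.subtypeEquivRight fun z => ?_)
    rw [exists_circuitOf_iff, or_iff_right (g.hor_ne_ver _ _).symm, hver]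
  rw [key, key, card_residues hw0 hvw]

end Grid

end FourValentMap

/-! ### Balance, and classification by the shift -/

namespace FourValentMap

namespace Grid

variable {G : FourValentMap} {g : G.Grid}

section NormalForm

variable {v h u : ℕ} {s : ℤ}

theorem mem_row_iff (h0 : 0 < h)
    (hL : ∀ x y, (x, y) ∈ g.L ↔ ∃ i j : ℤ, x = v * (u * i + s * j) ∧ y = h * j) (a : ℤ) :
    (a, 0) ∈ g.L ↔ ((v * u : ℕ) : ℤ) ∣ a := by
  rw [hL]
  constructor
  · rintro ⟨i, j, rfl, hj⟩
    obtain rfl : j = 0 := by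
      rcases mul_eq_zero.1 hj.symm with hj | hj <;> omega
    exact ⟨i, by push_cast; ring⟩
  · rintro ⟨i, rfl⟩
    exact ⟨i, 0, by push_cast; ring, by simp⟩

theorem mem_column_iff (v0 : 0 < v) (hus : IsCoprime (u : ℤ) s)
    (hL : ∀ x y, (x, y) ∈ g.L ↔ ∃ i j : ℤ, x = v * (u * i + s * j) ∧ y = h * j) (a : ℤ) :
    (0, a) ∈ g.L ↔ ((h * u : ℕ) : ℤ) ∣ a := by
  rw [hL]
  constructor
  · rintro ⟨i, j, hij, rfl⟩
    have hij : (u : ℤ) * i + s * j = 0 := by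
      rcases mul_eq_zero.1 hij.symm with hij | hij <;> omega
    obtain ⟨c, rfl⟩ : (u : ℤ) ∣ j := hus.dvd_of_dvd_mul_left ⟨-i, by linear_combination hij⟩
    exact ⟨c, by push_cast; ring⟩
  · rintro ⟨c, rfl⟩
    exact ⟨-s * c, u * c, by ring, by push_cast; ring⟩

theorem exists_mem_iff_fst (hus : IsCoprime (u : ℤ) s)
    (hL : ∀ x y, (x, y) ∈ g.L ↔ ∃ i j : ℤ, x = v * (u * i + s * j) ∧ y = h * j) (a : ℤ) :
    (∃ b, (a, b) ∈ g.L) ↔ (v : ℤ) ∣ a := by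
  simp only [hL]
  constructor
  · rintro ⟨_, i, j, rfl, -⟩
    exact dvd_mul_right _ _
  · rintro ⟨c, rfl⟩
    obtain ⟨p, q, hpq⟩ := hus
    exact ⟨_, p * c, q * c, by linear_combination -(v : ℤ) * c * hpq, rfl⟩

theorem exists_mem_iff_snd
    (hL : ∀ x y, (x, y) ∈ g.L ↔ ∃ i j : ℤ, x = v * (u * i + s * j) ∧ y = h * j) (b : ℤ) :
    (∃ a, (a, b) ∈ g.L) ↔ (h : ℤ) ∣ b := by
  simp only [hL]
  constructor
  · rintro ⟨_, i, j, -, rfl⟩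
    exact dvd_mul_right _ _
  · rintro ⟨j, rfl⟩
    exact ⟨_, 0, j, rfl, rfl⟩

end NormalForm

theorem mem_turn_row {w : ℕ} (hw : ∀ a, (0, a) ∈ g.L ↔ (w : ℤ) ∣ a) (a : ℤ) :
    (a, 0) ∈ g.turn.L ↔ (w : ℤ) ∣ a := by
  rw [mem_turn, neg_zero, hw]

theorem length_ver {w : ℕ} (hw : ∀ a, (0, a) ∈ g.L ↔ (w : ℤ) ∣ a) (x : ℤ) :
    G.length (g.ver x) = 2 * w := by
  rw [← length_hor (mem_turn_row hw) (1 - x), turn_hor, sub_sub_cancel]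

/-- Whether a circuit is covered by horizontal lines. -/
def IsHor (g : G.Grid) (C : G.CentralCircuit) : Prop := ∃ y, C = g.hor y

theorem isHor_hor (y : ℤ) : g.IsHor (g.hor y) := ⟨y, rfl⟩

theorem not_isHor_ver (x : ℤ) : ¬ g.IsHor (g.ver x) := fun ⟨y, h⟩ => g.hor_ne_ver x y h.symm

theorem exists_eq_ver {C : G.CentralCircuit} (h : ¬ g.IsHor C) : ∃ x, C = g.ver x :=
  (g.circuit_cases C).resolve_left h

/-- If the horizontal and the vertical lines are identified in the same way, there is an
involution of the circuits which exchanges the horizontal and the vertical ones. -/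
theorem exists_perm_isHor (h : ∀ y y', g.hor y = g.hor y' ↔ g.ver y = g.ver y') :
    ∃ σ : Equiv.Perm G.CentralCircuit, ∀ C, g.IsHor (σ C) ↔ ¬ g.IsHor C := by
  classical
  have hx : ∀ C, ∃ C', (∃ y, C = g.hor y ∧ C' = g.ver y) ∨ ∃ y, C = g.ver y ∧ C' = g.hor y := by
    intro C
    rcases g.circuit_cases C with ⟨y, rfl⟩ | ⟨y, rfl⟩
    · exact ⟨_, .inl ⟨y, rfl, rfl⟩⟩
    · exact ⟨_, .inr ⟨y, rfl, rfl⟩⟩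
  choose f hf using hx
  have hfh (y : ℤ) : f (g.hor y) = g.ver y := by
    rcases hf (g.hor y) with ⟨z, h1, h2⟩ | ⟨z, h1, h2⟩
    · rw [h2]; exact ((h _ _).1 h1).symm
    · exact (g.hor_ne_ver _ _ h1).elim
  have hfv (y : ℤ) : f (g.ver y) = g.hor y := by
    rcases hf (g.ver y) with ⟨z, h1, h2⟩ | ⟨z, h1, h2⟩
    · exact (g.hor_ne_ver _ _ h1.symm).elim
    · rw [h2]; exact ((h _ _).2 h1).symm
  refine ⟨Function.Involutive.toPerm f fun C => ?_, fun C => ?_⟩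
  · rcases g.circuit_cases C with ⟨y, rfl⟩ | ⟨y, rfl⟩ <;> simp only [hfh, hfv]
  · change g.IsHor (f C) ↔ _
    rcases g.circuit_cases C with ⟨y, rfl⟩ | ⟨y, rfl⟩ <;>
      simp only [hfh, hfv, isHor_hor, not_isHor_ver, not_true_eq_false, not_false_eq_true]

theorem isBalanced (g : G.Grid) : G.IsBalanced := by
  classical
  obtain ⟨v, h, u, s, v0, h0, u0, hus, hL⟩ := g.exists_normal_form
  have hrow := mem_row_iff h0 hL
  have hcol := mem_column_iff v0 hus hL
  have hfst := exists_mem_iff_fst hus hL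
  have hsnd := exists_mem_iff_snd hL
  have hI : ∃ I, ∀ x y, G.intersections (g.hor y) (g.ver x) = I :=
    ⟨G.intersections (g.hor 0) (g.ver 0), fun x y =>
      intersections_hor_ver (Nat.mul_pos v0 u0) (dvd_mul_right _ _) hrow hfst _ _ _ _⟩
  obtain ⟨I, hI⟩ := hI
  have hint (C C' : G.CentralCircuit) (hC : C' ≠ C) :
      G.intersections C C' = if (g.IsHor C ↔ g.IsHor C') then 0 else I := by
    by_cases h1 : g.IsHor C <;> by_cases h2 : g.IsHor C'
    · obtain ⟨y, rfl⟩ := h1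
      obtain ⟨y', rfl⟩ := h2
      simp [isHor_hor, intersections_hor_hor hC.symm]
    · obtain ⟨y, rfl⟩ := h1
      obtain ⟨x, rfl⟩ := exists_eq_ver h2
      simp [isHor_hor, not_isHor_ver, hI]
    · obtain ⟨y, rfl⟩ := h2
      obtain ⟨x, rfl⟩ := exists_eq_ver h1
      simp [isHor_hor, not_isHor_ver, intersections_comm (g.ver x), hI]
    · obtain ⟨x, rfl⟩ := exists_eq_ver h1
      obtain ⟨x', rfl⟩ := exists_eq_ver h2
      simp [not_isHor_ver, intersections_ver_ver hC.symm]
  -- Intersection numbers depend only on whether two circuits are parallel, so a permutation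
  -- respecting parallelism preserves intersection vectors.
  have key (C C' : G.CentralCircuit) (σ : Equiv.Perm G.CentralCircuit) (hσ : σ C = C')
      (hh : ∀ A B, (g.IsHor (σ A) ↔ g.IsHor (σ B)) ↔ (g.IsHor A ↔ g.IsHor B)) :
      G.intersectionVector C = G.intersectionVector C' := by
    unfold intersectionVector
    rw [selfIntersections_eq_zero g, selfIntersections_eq_zero g]
    refine Prod.ext rfl (funext fun k => Nat.card_congr (Equiv.subtypeEquiv σ fun A => ?_))
    rw [← hσ, Ne, Ne, σ.injective.eq_iff]
    refine and_congr_right fun hA => ?_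
    rw [hint _ _ hA, hint _ _ (fun h => hA (σ.injective h))]
    simp only [hh]
  have hswap (C C' : G.CentralCircuit) (hCC : g.IsHor C ↔ g.IsHor C') (A : G.CentralCircuit) :
      g.IsHor (Equiv.swap C C' A) ↔ g.IsHor A := by
    rcases eq_or_ne A C with rfl | h1
    · rw [Equiv.swap_apply_left, hCC]
    rcases eq_or_ne A C' with rfl | h2
    · rw [Equiv.swap_apply_right, hCC]
    rw [Equiv.swap_apply_of_ne_of_ne h1 h2]
  intro C C' hlen
  by_cases hCC : g.IsHor C ↔ g.IsHor C'
  · exact key C C' (Equiv.swap C C') (Equiv.swap_apply_left _ _) fun A B => by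
      rw [hswap C C' hCC, hswap C C' hCC]
  -- One circuit is horizontal, of length `2 v u`, the other vertical, of length `2 h u`.
  · have hvh : v = h := by
      have hl : ∀ x y, G.length (g.hor y) = G.length (g.ver x) → v = h := fun x y hl => by
        rw [length_hor hrow, length_ver hcol] at hl
        exact Nat.eq_of_mul_eq_mul_right u0 (by omega)
      by_cases h1 : g.IsHor C
      · obtain ⟨x, rfl⟩ := exists_eq_ver (g := g) (C := C') (by tauto)
        obtain ⟨y, rfl⟩ := h1
        exact hl _ _ hlen
      · obtain ⟨y, rfl⟩ : g.IsHor C' := by tauto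
        obtain ⟨x, rfl⟩ := exists_eq_ver h1
        exact hl _ _ hlen.symm
    obtain ⟨σ, hσ⟩ := g.exists_perm_isHor fun y y' => by
      rw [hor_eq_iff, ver_eq_iff]
      constructor
      · rintro ⟨a, b, hab, h1⟩
        obtain ⟨c, hc⟩ := (hfst b).2 (hvh ▸ (hsnd b).1 ⟨a, hab⟩)
        exact ⟨b, c, hc, h1⟩
      · rintro ⟨a, b, hab, h1⟩
        obtain ⟨c, hc⟩ := (hsnd a).2 (hvh ▸ (hfst a).1 ⟨b, hab⟩)
        exact ⟨c, a, hc, h1⟩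
    have hσC : g.IsHor (σ C) ↔ g.IsHor C' := by rw [hσ]; tauto
    -- Exchanging the directions sends `C` to a circuit parallel to `C'`; a swap of parallel
    -- circuits then moves it to `C'`.
    refine key C C' (σ.trans (Equiv.swap (σ C) C')) (Equiv.swap_apply_left _ _) fun A B => ?_
    simp only [Equiv.trans_apply, hswap _ _ hσC, hσ]
    tauto

/-- The normal form with `v = h = 1`: the parameter `j` is the second coordinate itself, and only
the congruence modulo `u` remains. -/
theorem IsFull.exists_params (hg : g.IsFull) : ∃ (u : ℕ) (s : ℤ), 0 < u ∧ IsCoprime (u : ℤ) s ∧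
    G.numVertices = 2 * u ∧ ∀ x y, (x, y) ∈ g.L ↔ (u : ℤ) ∣ x - s * y := by
  obtain ⟨v, h, u, s, v0, h0, u0, hus, hL⟩ := g.exists_normal_form
  have h1 := (exists_mem_iff_snd hL 1).1 hg.1
  have h2 := (exists_mem_iff_fst hus hL 1).1 hg.2
  obtain rfl : h = 1 := by simpa using Int.natCast_dvd_natCast.1 h1
  obtain rfl : v = 1 := by simpa using Int.natCast_dvd_natCast.1 h2
  have hrow := mem_row_iff h0 hL
  refine ⟨u, s, u0, hus, ?_, fun x y => ?_⟩
  · rw [numVertices_eq hrow fun y => hg.hor_eq y 0, one_mul]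
  · rw [hL]
    simp only [Nat.cast_one, one_mul]
    constructor
    · rintro ⟨i, j, rfl, rfl⟩
      exact ⟨i, by ring⟩
    · rintro ⟨i, hi⟩
      exact ⟨i, y, by linear_combination hi, rfl⟩

/-- Shifts are the nonnegative integers congruent to `s` or `-s` modulo `u`. Exactly one of them is
at most `u / 2`, and congruence preserves coprimality to `u`. -/
theorem IsFull.exists_shift (hg : g.IsFull) : Even G.numVertices ∧ ∃ j : ℕ,
    4 * j ≤ G.numVertices ∧ Nat.gcd (G.numVertices / 2) j = 1 ∧ G.IsShift (g.hor 0) j ∧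
      ∀ j' : ℕ, 4 * j' ≤ G.numVertices → G.IsShift (g.hor 0) j' → j' = j := by
  obtain ⟨u, s, u0, hus, hn, hL⟩ := hg.exists_params
  have hs (j : ℕ) : G.IsShift (g.hor 0) j ↔ (u : ℤ) ∣ j - s ∨ (u : ℤ) ∣ j + s := by
    rw [hg.isShift_iff, hL, hL]; simp
  have hex : ∃ j : ℕ, 2 * j ≤ u ∧ ((u : ℤ) ∣ j - s ∨ (u : ℤ) ∣ j + s) := by
    have h1 := Int.emod_nonneg s (show (u : ℤ) ≠ 0 by omega)
    have h2 := Int.emod_lt_of_pos s (show (0 : ℤ) < u by omega)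
    have h3 := Int.emod_add_mul_ediv s u
    rcases le_or_gt (2 * (s % u)) u with h | h
    · exact ⟨(s % u).toNat, by omega, .inl ⟨-(s / u), by
        rw [Int.toNat_of_nonneg h1]; linear_combination h3⟩⟩
    · exact ⟨(u - s % u).toNat, by omega, .inr ⟨1 + s / u, by
        rw [Int.toNat_of_nonneg (by omega)]; linear_combination -h3⟩⟩
  obtain ⟨j, hj, hjs⟩ := hex
  rw [hn]
  refine ⟨even_two_mul _, j, by omega, ?_, (hs j).2 hjs, fun j' hj' hj's => ?_⟩
  · rw [Nat.mul_div_cancel_left _ two_pos]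
    refine Nat.isCoprime_iff_coprime.1 ?_
    rcases hjs with ⟨c, hc⟩ | ⟨c, hc⟩
    · rw [show (j : ℤ) = s + u * c by linear_combination hc]
      exact IsCoprime.add_mul_left_right hus c
    · rw [show (j : ℤ) = -s + u * c by linear_combination hc]
      exact IsCoprime.add_mul_left_right hus.neg_right c
  · have hd : (u : ℤ) ∣ j' - j ∨ (u : ℤ) ∣ j' + j := by
      rcases hjs with h1 | h1 <;> rcases (hs j').1 hj's with h2 | h2
      · exact .inl (by simpa using dvd_sub h2 h1)
      · exact .inr (by have := dvd_add h2 h1; ring_nf at this ⊢; exact this)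
      · exact .inr (by have := dvd_add h2 h1; ring_nf at this ⊢; exact this)
      · exact .inl (by simpa using dvd_sub h2 h1)
    rcases hd with hd | hd
    · have := Int.eq_zero_of_abs_lt_dvd hd (by rw [abs_lt]; omega)
      omega
    -- Here `u` divides `j' + j ≤ u`; if the sum is positive it equals `u`, and both summands are `u
    -- / 2`.
    · rcases Nat.eq_zero_or_pos (j' + j) with h | h
      · omega
      · have := Int.le_of_dvd (by omega) hd
        omega

/-- A common shift determines `s` modulo `u` up to sign. Equal signs give the same lattice, opposite
signs give mirror images. -/
theorem IsFull.iso {H : FourValentMap} {g' : H.Grid} (hg : g.IsFull) (hg' : g'.IsFull)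
    (hn : G.numVertices = H.numVertices) {j : ℕ} (hj : G.IsShift (g.hor 0) j)
    (hj' : H.IsShift (g'.hor 0) j) : G.Iso H := by
  obtain ⟨u, s, u0, hus, hu, hL⟩ := hg.exists_params
  obtain ⟨u', s', u0', hus', hu', hL'⟩ := hg'.exists_params
  obtain rfl : u = u' := by omega
  have h1 : (u : ℤ) ∣ j - s ∨ (u : ℤ) ∣ j + s := by
    rw [hg.isShift_iff, hL, hL] at hj; simpa using hj
  have h2 : (u : ℤ) ∣ j - s' ∨ (u : ℤ) ∣ j + s' := by
    rw [hg'.isShift_iff, hL', hL'] at hj'; simpa using hj'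
  have h3 : (u : ℤ) ∣ s - s' ∨ (u : ℤ) ∣ s + s' := by
    rcases h1 with h1 | h1 <;> rcases h2 with h2 | h2
    · exact .inl (by have := dvd_sub h2 h1; ring_nf at this ⊢; exact this)
    · exact .inr (by have := dvd_sub h2 h1; ring_nf at this ⊢; exact this)
    · exact .inr (by have := dvd_sub h1 h2; ring_nf at this ⊢; exact this)
    · exact .inl (by have := dvd_sub h1 h2; ring_nf at this ⊢; exact this)
  rcases h3 with h3 | h3
  · refine iso_of_lattice g g' 1 (.inl rfl) fun a b => ?_
    rw [hL, hL', ← dvd_add_left (h3.mul_left b)]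
    ring_nf
  · refine iso_of_lattice g g' (-1) (.inr rfl) fun a b => ?_
    rw [hL, hL', ← dvd_neg, ← dvd_sub_left (h3.mul_left b)]
    ring_nf

end Grid

end FourValentMap

/-! ### A full lattice yields a `4`-hedrite -/

namespace FourValentMap

namespace Grid

variable {G : FourValentMap} {g : G.Grid}

/-- A digon has two darts. An odd power of `face` turns the direction `0` to `1`, which `ne_one`
separates from direction `0`, so the digon has just one dart lifting to direction `0`. -/
theorem leftFace_eq_iff_of_mem {x y x' y' : ℤ} (h : (x, y) ∈ g.L) :
    G.leftFace (g.D x y 0) = G.leftFace (g.D x' y' 0) ↔ g.D x y 0 = g.D x' y' 0 := by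
  refine ⟨fun hf => ?_, fun hf => by rw [hf]⟩
  obtain ⟨n, hn⟩ := (Quotient.exact hf :
    Equiv.Perm.SameCycle G.face (g.D x y 0) (g.D x' y' 0)).exists_nat_pow_eq
  rw [← g.isGon_two_iff, FourValentMap.isGon_two_iff g.face_ne] at h
  have h2 (m : ℕ) : (G.face ^ (2 * m)) (g.D x y 0) = g.D x y 0 := by
    induction m with
    | zero => rfl
    | succ m ih =>
      rw [mul_add, pow_add, Equiv.Perm.mul_apply]
      exact (congrArg (G.face ^ (2 * m)) h).trans ih
  obtain ⟨m, rfl | rfl⟩ := Nat.even_or_odd' n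
  · rw [← hn, h2]
  · rw [pow_succ', Equiv.Perm.mul_apply, h2, g.face_D, zero_add] at hn
    exact (g.ne_one _ _ _ _ hn.symm).elim

/-- Digons correspond to `L / 2 L`, which has order four; the representatives come from the basis
`(u, 0)`, `(s, 1)`. -/
theorem IsFull.numGons_two (hg : g.IsFull) : G.numGons 2 = 4 := by
  obtain ⟨u, s, u0, -, -, hL⟩ := hg.exists_params
  have hmem (i j : ℤ) : (u * i + s * j, j) ∈ g.L := (hL _ _).2 ⟨i, by ring⟩
  have h4 : Nat.card (Fin 2 × Fin 2) = 4 := by simp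
  rw [← h4]
  refine (Nat.card_congr (Equiv.ofBijective
    (fun p : Fin 2 × Fin 2 => (⟨G.leftFace (g.D (u * p.1 + s * p.2) p.2 0),
      (g.isGon_two_iff _ _).2 (hmem _ _)⟩ : {f : G.Face // G.IsGon 2 f})) ⟨?_, ?_⟩)).symm
  · rintro ⟨i, j⟩ ⟨i', j'⟩ hij
    have := (leftFace_eq_iff_of_mem (hmem _ _)).1 (congrArg Subtype.val hij)
    obtain ⟨a, b, hab, h1, h2⟩ := (g.zero_iff _ _ _ _).1 this
    simp only at h1 h2
    obtain rfl : j = j' := by omega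
    obtain rfl : b = 0 := by omega
    obtain ⟨c, hc⟩ := (hL _ _).1 hab
    have h3 : (u : ℤ) * (i' - i) = u * (2 * c) := by linear_combination h1 + 2 * hc
    have h4 := mul_left_cancel₀ (by omega) h3
    obtain rfl : i = i' := by omega
    rfl
  · rintro ⟨f, hf⟩
    obtain ⟨x, y, rfl⟩ := g.leftFace_cases f
    rw [isGon_two_iff, hL] at hf
    obtain ⟨c, hc⟩ := hf
    have hmod (z : ℤ) : ∃ (i : Fin 2) (a : ℤ), z = i + 2 * a := by
      obtain ⟨a, rfl | rfl⟩ := Int.even_or_odd' z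
      · exact ⟨0, a, by simp⟩
      · exact ⟨1, a, by simp [add_comm]⟩
    obtain ⟨i, a, rfl⟩ := hmod c
    obtain ⟨j, b, rfl⟩ := hmod y
    refine ⟨(i, j), Subtype.ext (congrArg G.leftFace ?_)⟩
    exact (g.zero_iff _ _ _ _).2 ⟨_, b, hmem a b, by linear_combination hc, rfl⟩

/-- The single horizontal circuit is a Hamiltonian cycle, and deleting one vertex of a cycle leaves
a path. -/
theorem IsFull.isTwoConnected (hg : g.IsFull) : G.IsTwoConnected := by
  obtain ⟨w, w0, hw⟩ := exists_dvd_of_subgroup (g.L.comap (AddMonoidHom.inl ℤ ℤ))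
    g.exists_pos_mem.choose_spec.1 g.exists_pos_mem.choose_spec.2
  change ∀ x, (x, 0) ∈ g.L ↔ _ at hw
  let V : ℤ → G.Vertex := fun i => G.vertexOf (g.D i 0 0)
  have hV (i j : ℤ) : V i = V j ↔ ((2 * w : ℕ) : ℤ) ∣ j - i := vertexOf_row_eq_iff hw 0 i j
  have hsurj (v : G.Vertex) : ∃ i, v = V i := by
    rw [← vertex_on_hor_iff]
    obtain ⟨x, y, rfl⟩ := g.exists_vertexOf v
    exact ⟨_, rfl, (g.circuitOf_zero _ _).trans (hg.hor_eq _ _)⟩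
  have hrep (x : ℤ) (v : G.Vertex) : ∃ n : ℕ, n < 2 * w ∧ v = V (x + n) := by
    obtain ⟨i, rfl⟩ := hsurj v
    have h1 := Int.emod_nonneg (i - x) (show ((2 * w : ℕ) : ℤ) ≠ 0 by omega)
    have h2 := Int.emod_lt_of_pos (i - x) (show (0 : ℤ) < (2 * w : ℕ) by omega)
    refine ⟨((i - x) % (2 * w : ℕ)).toNat, by omega, (hV _ _).2 ?_⟩
    rw [Int.toNat_of_nonneg h1]
    exact ⟨-((i - x) / (2 * w : ℕ)), by
      linear_combination Int.emod_add_mul_ediv (i - x) (2 * w : ℕ)⟩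
  have hadj (i : ℤ) : G.Adj (V i) (V (i + 1)) :=
    ⟨g.D i 0 0, rfl, by rw [g.rev_D, g.vertexOf_D]; simp [V]⟩
  have hsymm : Std.Symm G.Adj := ⟨by
    rintro _ _ ⟨d, rfl, rfl⟩
    exact ⟨G.rev d, rfl, by rw [G.rev_rev]⟩⟩
  refine ⟨⟨⟨V 0⟩, fun a b => ?_⟩, fun v a b ha hb => ?_⟩
  · have key (n : ℕ) : Relation.ReflTransGen G.Adj (V 0) (V n) := by
      induction n with
      | zero => exact .refl
      | succ n ih => exact ih.tail (by simpa using hadj n)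
    obtain ⟨n, -, rfl⟩ := hrep 0 a
    obtain ⟨m, -, rfl⟩ := hrep 0 b
    rw [zero_add, zero_add]
    exact (Relation.ReflTransGen.stdSymm.symm _ _ (key n)).trans (key m)
  · obtain ⟨x, rfl⟩ := hsurj v
    have hne (n : ℕ) (h0 : 0 < n) (hn : n < 2 * w) : V (x + n) ≠ V x := by
      rw [Ne, eq_comm, hV, add_sub_cancel_left, Int.natCast_dvd_natCast]
      exact Nat.not_dvd_of_pos_of_lt h0 hn
    have hsymm' : Std.Symm fun a b => G.Adj a b ∧ a ≠ V x ∧ b ≠ V x :=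
      ⟨fun a b h => ⟨hsymm.symm _ _ h.1, h.2.2, h.2.1⟩⟩
    have key (n : ℕ) (hn : n + 1 < 2 * w) :
        Relation.ReflTransGen (fun a b => G.Adj a b ∧ a ≠ V x ∧ b ≠ V x)
          (V (x + (0 + 1 : ℕ))) (V (x + (n + 1 : ℕ))) := by
      induction n with
      | zero => exact .refl
      | succ n ih =>
        refine (ih (by omega)).tail ⟨?_, hne _ (by omega) (by omega), hne _ (by omega) hn⟩
        have := hadj (x + (n + 1 : ℕ))
        rwa [add_assoc] at this
    have hpos (a : G.Vertex) (ha : a ≠ V x) : ∃ n : ℕ, n + 1 < 2 * w ∧ a = V (x + (n + 1 : ℕ)) := by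
      obtain ⟨n, hn, rfl⟩ := hrep x a
      cases n with
      | zero => simp at ha
      | succ n => exact ⟨n, hn, rfl⟩
    obtain ⟨n, hn, rfl⟩ := hpos a ha
    obtain ⟨m, hm, rfl⟩ := hpos b hb
    exact (Relation.ReflTransGen.stdSymm.symm _ _ (key n hn)).trans (key m hm)

theorem IsFull.isHedrite (hg : g.IsFull) : G.IsHedrite 4 :=
  isHedrite_four_iff.2 ⟨hg.isTwoConnected, g.isGon, hg.numGons_two⟩

end Grid

/-! ### Realising every full lattice -/

/-- Reversal in `spiral`. -/
def spiralRev (u : ℕ) (s : ℤ) (p : ZMod (2 * u) × ZMod 4) : ZMod (2 * u) × ZMod 4 :=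
  if p.2 = 0 then (p.1 + 1, 2) else if p.2 = 2 then (p.1 - 1, 0) else
    if p.2 = 1 then (2 * s + 1 - p.1, 1) else (1 - p.1, 3)

theorem spiralRev_spiralRev (u : ℕ) (s : ℤ) (p : ZMod (2 * u) × ZMod 4) :
    spiralRev u s (spiralRev u s p) = p := by
  obtain ⟨x, k⟩ := p
  have hk : k = 0 ∨ k = 1 ∨ k = 2 ∨ k = 3 := by revert k; decide
  rcases hk with rfl | rfl | rfl | rfl <;>
    simp [spiralRev, show (1 : ZMod 4) ≠ 0 by decide, show (1 : ZMod 4) ≠ 2 by decide,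
      show (2 : ZMod 4) ≠ 0 by decide, show (3 : ZMod 4) ≠ 0 by decide,
      show (3 : ZMod 4) ≠ 2 by decide, show (3 : ZMod 4) ≠ 1 by decide]

theorem spiralRev_ne (u : ℕ) (s : ℤ) (p : ZMod (2 * u) × ZMod 4) : spiralRev u s p ≠ p := by
  obtain ⟨x, k⟩ := p
  -- The modulus `2 * u` is even, and modulo `2` the two sides are `1 - x` and `x`.
  have key (c : ℤ) : (2 * c + 1 - x : ZMod (2 * u)) ≠ x := by
    intro h
    have h2 := congrArg (ZMod.castHom (dvd_mul_right 2 u) (ZMod 2)) h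
    simp only [map_sub, map_add, map_mul, map_one, map_intCast] at h2
    rw [show (ZMod.castHom (dvd_mul_right 2 u) (ZMod 2)) 2 = 0 from map_ofNat _ 2] at h2
    generalize (ZMod.castHom (dvd_mul_right 2 u) (ZMod 2)) x = z at h2
    rw [zero_mul] at h2
    revert z; decide
  have hk : k = 0 ∨ k = 1 ∨ k = 2 ∨ k = 3 := by revert k; decide
  rcases hk with rfl | rfl | rfl | rfl <;>
    simp [spiralRev, show (1 : ZMod 4) ≠ 0 by decide, show (1 : ZMod 4) ≠ 2 by decide,
      show (2 : ZMod 4) ≠ 0 by decide, show (3 : ZMod 4) ≠ 0 by decide,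
      show (3 : ZMod 4) ≠ 2 by decide, show (3 : ZMod 4) ≠ 1 by decide,
      show (0 : ZMod 4) ≠ 2 by decide]
  · exact key s
  · simpa using key 0

/-- A cycle of length `2 u` drawn on the sphere, whose vertices are paired by an edge on each
side: `x` with `2 s + 1 - x` on the left and `x` with `1 - x` on the right. -/
def spiral (u : ℕ) (s : ℤ) (hu : 0 < u) : FourValentMap where
  Dart := ZMod (2 * u) × ZMod 4
  finite_dart := by
    have : NeZero (2 * u) := ⟨by omega⟩
    infer_instance
  rot := Equiv.prodCongr (Equiv.refl _) (Equiv.addRight 1)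
  rev := Function.Involutive.toPerm (spiralRev u s) (spiralRev_spiralRev u s)
  rot_four := by
    rintro ⟨x, k⟩
    have h : k + 1 + 1 + 1 + 1 = k := by revert k; decide
    exact Prod.ext rfl h
  rot_two_ne := by
    rintro ⟨x, k⟩ h
    have h2 : k + 1 + 1 = k := congrArg Prod.snd h
    clear h
    revert k; decide
  rev_rev := spiralRev_spiralRev u s
  rev_ne := spiralRev_ne u s

/-- The covering of `spiral u s` by the square grid. -/
def spiralD (u : ℕ) (s x y : ℤ) (k : ZMod 4) : ZMod (2 * u) × ZMod 4 :=
  if Even y then ((1 - x + s * y : ℤ), k + 2) else ((x - s * (y - 1) : ℤ), k)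

theorem spiralD_even (u : ℕ) (s x c : ℤ) (k : ZMod 4) :
    spiralD u s x (2 * c) k = (((1 - x + s * (2 * c) : ℤ) : ZMod (2 * u)), k + 2) := by
  rw [spiralD, if_pos (even_two_mul c)]

theorem spiralD_odd (u : ℕ) (s x c : ℤ) (k : ZMod 4) :
    spiralD u s x (2 * c + 1) k = (((x - s * (2 * c) : ℤ) : ZMod (2 * u)), k) := by
  rw [spiralD, if_neg (Int.not_even_two_mul_add_one c), add_sub_cancel_right]

theorem spiralRev_spiralD (u : ℕ) (s x y : ℤ) (k : ZMod 4) :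
    spiralRev u s (spiralD u s x y k) = spiralD u s (x + dirX k) (y + dirY k) (k + 2) := by
  have hk : k = 0 ∨ k = 1 ∨ k = 2 ∨ k = 3 := by revert k; decide
  have e4 : (2 + 2 : ZMod 4) = 0 := by decide
  have e5 : (3 + 2 : ZMod 4) = 1 := by decide
  have e3 : (1 + 2 : ZMod 4) = 3 := by decide
  have n1 : (1 : ZMod 4) ≠ 0 := by decide
  have n2 : (1 : ZMod 4) ≠ 2 := by decide
  have n3 : (2 : ZMod 4) ≠ 0 := by decide
  have n4 : (3 : ZMod 4) ≠ 0 := by decide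
  have n5 : (3 : ZMod 4) ≠ 2 := by decide
  have n6 : (3 : ZMod 4) ≠ 1 := by decide
  obtain ⟨c, rfl | rfl⟩ := Int.even_or_odd' y <;> rcases hk with rfl | rfl | rfl | rfl
  · simp [spiralD_even, spiralRev, e4, n3]
    ring
  · simp [spiralD_even, spiralD_odd, spiralRev, e3, n4, n5, n6]
    ring
  · simp [spiralD_even, spiralRev, e4]
    ring
  · rw [show 2 * c + dirY 3 = 2 * (c - 1) + 1 by simp; ring]
    simp [spiralD_even, spiralD_odd, spiralRev, e5, n1, n2]
    ring
  · simp [spiralD_odd, spiralRev]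
    ring
  · rw [show 2 * c + 1 + dirY 1 = 2 * (c + 1) by simp; ring]
    simp [spiralD_even, spiralD_odd, spiralRev, e3, e5, n1, n2]
    ring
  · simp [spiralD_odd, spiralRev, e4, n3]
    ring
  · simp [spiralD_even, spiralD_odd, spiralRev, e3, e5, n4, n5, n6]
    ring

theorem spiralD_zero_eq_iff (u : ℕ) (s x y x' y' : ℤ) :
    spiralD u s x y 0 = spiralD u s x' y' 0 ↔
      ∃ a b, (u : ℤ) ∣ a - s * b ∧ x' = x + 2 * a ∧ y' = y + 2 * b := by
  have e : (0 : ZMod 4) ≠ 2 := by decide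
  obtain ⟨c, rfl | rfl⟩ := Int.even_or_odd' y <;> obtain ⟨c', rfl | rfl⟩ := Int.even_or_odd' y'
  · rw [spiralD_even, spiralD_even, Prod.mk.injEq, and_iff_left rfl,
      ZMod.intCast_eq_intCast_iff_dvd_sub]
    push_cast
    constructor
    · rintro ⟨t, ht⟩
      exact ⟨s * (c' - c) - u * t, c' - c, ⟨-t, by ring⟩, by linear_combination -ht, by ring⟩
    · rintro ⟨a, b, ⟨t, ht⟩, h1, h2⟩
      exact ⟨-t, by linear_combination -h1 + s * h2 - 2 * ht⟩
  · rw [spiralD_even, spiralD_odd, Prod.mk.injEq]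
    simp only [zero_add, e.symm, and_false, false_iff]
    rintro ⟨a, b, -, -, h⟩
    omega
  · rw [spiralD_even, spiralD_odd, Prod.mk.injEq]
    simp only [zero_add, e, and_false, false_iff]
    rintro ⟨a, b, -, -, h⟩
    omega
  · rw [spiralD_odd, spiralD_odd, Prod.mk.injEq, and_iff_left rfl,
      ZMod.intCast_eq_intCast_iff_dvd_sub]
    push_cast
    constructor
    · rintro ⟨t, ht⟩
      exact ⟨u * t + s * (c' - c), c' - c, ⟨t, by ring⟩, by linear_combination ht, by ring⟩
    · rintro ⟨a, b, ⟨t, ht⟩, h1, h2⟩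
      exact ⟨t, by linear_combination h1 - s * h2 + 2 * ht⟩

theorem spiralD_zero_ne_one (u : ℕ) (s x y x' y' : ℤ) :
    spiralD u s x y 0 ≠ spiralD u s x' y' 1 := by
  intro h
  have h2 := congrArg Prod.snd h
  clear h
  unfold spiralD at h2
  split_ifs at h2 <;> dsimp only at h2 <;> revert h2 <;> decide

/-- Row `1` runs forwards along the cycle. Even rows run backwards, and each change of `y` by `2`
displaces the row by `2 s`, which encodes `(s, 1) ∈ L`. -/
theorem exists_grid_spiral (u : ℕ) (s : ℤ) (hu : 0 < u) : ∃ g : (spiral u s hu).Grid,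
    ∀ x y, (x, y) ∈ g.L ↔ (u : ℤ) ∣ x - s * y := by
  refine ⟨{
    D := spiralD u s
    rot_D := fun x y k => ?_
    rev_D := spiralRev_spiralD u s
    surj := ?_
    L := (AddSubgroup.zmultiples (u : ℤ)).comap
      (AddMonoidHom.fst ℤ ℤ - s • AddMonoidHom.snd ℤ ℤ)
    half := ?_
    zero_iff := fun x y x' y' => ?_
    ne_one := fun x y x' y' => ?_ }, fun x y => ?_⟩
  · unfold spiralD
    split_ifs
    · exact Prod.ext rfl (add_right_comm k 2 1)
    · rfl
  · rintro ⟨x, k⟩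
    exact ⟨x.cast, 2 * 0 + 1, k, (spiralD_odd _ _ _ _ _).trans (by simp)⟩
  · refine (spiralD_even u s 0 0 0).trans ((spiralD_odd u s 1 0 2).trans ?_).symm
    simp
  · have hmem (a b : ℤ) : (a, b) ∈ (AddSubgroup.zmultiples (u : ℤ)).comap
        (AddMonoidHom.fst ℤ ℤ - s • AddMonoidHom.snd ℤ ℤ) ↔ (u : ℤ) ∣ a - s * b := by
      simp [Int.mem_zmultiples_iff]
    simp only [hmem]
    exact spiralD_zero_eq_iff u s x y x' y'
  · exact spiralD_zero_ne_one u s x y x' y'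
  · simp [Int.mem_zmultiples_iff]

end FourValentMap

/-! ### Inflation stretches the lattice -/

namespace FourValentMap

/-- The cell of width `v` which contains `x`, where the cell `1` starts at `1`. -/
def cell (v : ℕ) (x : ℤ) : ℤ := (x - 1) / v + 1

/-- The position of `x` in its cell. -/
def cellPos (v : ℕ) (x : ℤ) : ℕ := ((x - 1) % v).toNat

section Cell

variable {v : ℕ}

theorem cell_spec (hv : 0 < v) (x : ℤ) :
    cellPos v x < v ∧ x = v * (cell v x - 1) + cellPos v x + 1 := by
  have h1 := Int.emod_nonneg (x - 1) (show (v : ℤ) ≠ 0 by omega)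
  have h2 := Int.emod_lt_of_pos (x - 1) (show (0 : ℤ) < v by omega)
  refine ⟨by unfold cellPos; omega, ?_⟩
  rw [cell, cellPos, Int.toNat_of_nonneg h1]
  linear_combination -Int.emod_add_mul_ediv (x - 1) v

theorem cell_eq {x q : ℤ} {r : ℕ} (hr : r < v) (h : x = v * (q - 1) + r + 1) :
    cell v x = q ∧ cellPos v x = r := by
  have h1 : x - 1 = r + v * (q - 1) := by linear_combination h
  constructor
  · rw [cell, h1, Int.add_mul_ediv_left _ _ (by omega), Int.ediv_eq_zero_of_lt (by omega) (by omega)]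
    ring
  · rw [cellPos, h1, Int.add_mul_emod_self_left, Int.emod_eq_of_lt (by omega) (by omega)]
    simp

theorem cell_add_one_of_lt {x : ℤ} (h : cellPos v x + 1 < v) :
    cell v (x + 1) = cell v x ∧ cellPos v (x + 1) = cellPos v x + 1 :=
  cell_eq h (by
    push_cast
    linear_combination (cell_spec (show 0 < v by omega) x).2)

theorem cell_add_one_of_eq {x : ℤ} (h : cellPos v x + 1 = v) :
    cell v (x + 1) = cell v x + 1 ∧ cellPos v (x + 1) = 0 :=
  cell_eq (by omega) (by
    have : (cellPos v x : ℤ) + 1 = v := by exact_mod_cast h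
    push_cast
    linear_combination (cell_spec (show 0 < v by omega) x).2 + this)

theorem cell_sub_one_of_pos (hv : 0 < v) {x : ℤ} (h : 0 < cellPos v x) :
    cell v (x - 1) = cell v x ∧ cellPos v (x - 1) = cellPos v x - 1 := by
  have := cell_spec hv x
  exact cell_eq (by omega) (by
    rw [Nat.cast_sub (by omega)]
    linear_combination this.2)

theorem cell_sub_one_of_eq (hv : 0 < v) {x : ℤ} (h : cellPos v x = 0) :
    cell v (x - 1) = cell v x - 1 ∧ cellPos v (x - 1) = v - 1 := by
  have := (cell_spec hv x).2
  rw [h] at this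
  exact cell_eq (by omega) (by
    rw [Nat.cast_sub (by omega)]
    push_cast at this ⊢
    linear_combination this)

end Cell

namespace Grid

variable {H : FourValentMap} (g : H.Grid) (t : H.CentralCircuit → ℕ+)

/-- The dart of an inflation at the grid point `(x, y)` in direction `k`, when `v` and `h` are the
numbers of copies of the vertical and of the horizontal circuits. -/
def inflatedD (v h : ℕ) (x y : ℤ) (k : ZMod 4) : H.Dart × ℕ × ℕ :=
  (g.D (cell v x) (cell h y) k,
    if k = 0 then (cellPos v x, cellPos h y) else
    if k = 1 then (cellPos h y, v - 1 - cellPos v x) else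
    if k = 2 then (v - 1 - cellPos v x, h - 1 - cellPos h y) else
    (h - 1 - cellPos h y, cellPos v x))

theorem inflatedD_zero (v h : ℕ) (x y : ℤ) : g.inflatedD v h x y 0 =
    (g.D (cell v x) (cell h y) 0, cellPos v x, cellPos h y) := rfl

theorem inflatedD_one (v h : ℕ) (x y : ℤ) : g.inflatedD v h x y 1 =
    (g.D (cell v x) (cell h y) 1, cellPos h y, v - 1 - cellPos v x) := rfl

theorem inflatedD_two (v h : ℕ) (x y : ℤ) : g.inflatedD v h x y 2 =
    (g.D (cell v x) (cell h y) 2, v - 1 - cellPos v x, h - 1 - cellPos h y) := rfl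

theorem inflatedD_three (v h : ℕ) (x y : ℤ) : g.inflatedD v h x y 3 =
    (g.D (cell v x) (cell h y) 3, h - 1 - cellPos h y, cellPos v x) := rfl

variable {g t} {v h : ℕ}

theorem mult_D (hh : ∀ y, (t (g.hor y) : ℕ) = h) (hv : ∀ x, (t (g.ver x) : ℕ) = v) (x y : ℤ) :
    H.mult t (g.D x y 0) = h ∧ H.mult t (g.D x y 1) = v ∧ H.mult t (g.D x y 2) = h ∧
      H.mult t (g.D x y 3) = v :=
  ⟨by rw [mult, circuitOf_zero, hh], by rw [mult, circuitOf_one, hv],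
    by rw [mult, circuitOf_two, hh], by rw [mult, circuitOf_three, hv]⟩

theorem isInflatedDart_inflatedD (hh : ∀ y, (t (g.hor y) : ℕ) = h)
    (hv : ∀ x, (t (g.ver x) : ℕ) = v) (x y : ℤ) (k : ZMod 4) :
    H.IsInflatedDart t (g.inflatedD v h x y k) := by
  have hv0 : 0 < v := hv 0 ▸ (t (g.ver 0)).pos
  have hh0 : 0 < h := hh 0 ▸ (t (g.hor 0)).pos
  have h1 := (cell_spec hv0 x).1
  have h2 := (cell_spec hh0 y).1
  obtain ⟨m0, m1, m2, m3⟩ := mult_D hh hv (cell v x) (cell h y)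
  have hk : k = 0 ∨ k = 1 ∨ k = 2 ∨ k = 3 := by revert k; decide
  rcases hk with rfl | rfl | rfl | rfl
  · rw [inflatedD_zero, IsInflatedDart, g.rot_D, zero_add, m0, m1]
    exact ⟨h1, h2⟩
  · rw [inflatedD_one, IsInflatedDart, g.rot_D, show (1 + 1 : ZMod 4) = 2 by decide, m1, m2]
    exact ⟨h2, by dsimp only; omega⟩
  · rw [inflatedD_two, IsInflatedDart, g.rot_D, show (2 + 1 : ZMod 4) = 3 by decide, m2, m3]
    exact ⟨by dsimp only; omega, by dsimp only; omega⟩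
  · rw [inflatedD_three, IsInflatedDart, g.rot_D, show (3 + 1 : ZMod 4) = 0 by decide, m0, m3]
    exact ⟨by dsimp only; omega, h1⟩

theorem inflatedRot_inflatedD (hh : ∀ y, (t (g.hor y) : ℕ) = h)
    (hv : ∀ x, (t (g.ver x) : ℕ) = v) (x y : ℤ) (k : ZMod 4) :
    H.inflatedRot t (g.inflatedD v h x y k) = g.inflatedD v h x y (k + 1) := by
  have hv0 : 0 < v := hv 0 ▸ (t (g.ver 0)).pos
  have hh0 : 0 < h := hh 0 ▸ (t (g.hor 0)).pos
  have h1 := (cell_spec hv0 x).1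
  have h2 := (cell_spec hh0 y).1
  obtain ⟨m0, m1, m2, m3⟩ := mult_D hh hv (cell v x) (cell h y)
  have hk : k = 0 ∨ k = 1 ∨ k = 2 ∨ k = 3 := by revert k; decide
  rcases hk with rfl | rfl | rfl | rfl
  · rw [zero_add, inflatedD_zero, inflatedD_one, inflatedRot, g.rot_D, zero_add, m1]
  · rw [show (1 + 1 : ZMod 4) = 2 by decide, inflatedD_one, inflatedD_two, inflatedRot, g.rot_D,
      show (1 + 1 : ZMod 4) = 2 by decide, m2]
  · rw [show (2 + 1 : ZMod 4) = 3 by decide, inflatedD_two, inflatedD_three, inflatedRot, g.rot_D,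
      show (2 + 1 : ZMod 4) = 3 by decide, m3]
    simp only [Prod.mk.injEq, true_and]
    omega
  · rw [show (3 + 1 : ZMod 4) = 0 by decide, inflatedD_three, inflatedD_zero, inflatedRot, g.rot_D,
      show (3 + 1 : ZMod 4) = 0 by decide, m0]
    simp only [Prod.mk.injEq, true_and]
    omega

/-- A step inside a cell changes only the position; a step across its border passes to the adjacent
cell, hence along an old edge of `H`. These are the two branches of `inflatedRev`. -/
theorem inflatedRev_inflatedD (hh : ∀ y, (t (g.hor y) : ℕ) = h)
    (hv : ∀ x, (t (g.ver x) : ℕ) = v) (x y : ℤ) (k : ZMod 4) :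
    H.inflatedRev t (g.inflatedD v h x y k) =
      g.inflatedD v h (x + dirX k) (y + dirY k) (k + 2) := by
  have hv0 : 0 < v := hv 0 ▸ (t (g.ver 0)).pos
  have hh0 : 0 < h := hh 0 ▸ (t (g.hor 0)).pos
  have h1 := (cell_spec hv0 x).1
  have h2 := (cell_spec hh0 y).1
  obtain ⟨m0, m1, m2, m3⟩ := mult_D hh hv (cell v x) (cell h y)
  have e1 : (1 + 1 : ZMod 4) = 2 := by decide
  have e2 : (2 + 1 : ZMod 4) = 3 := by decide
  have e3 : (3 + 1 : ZMod 4) = 0 := by decide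
  have f1 : (1 + 2 : ZMod 4) = 3 := by decide
  have f2 : (2 + 2 : ZMod 4) = 0 := by decide
  have f3 : (3 + 2 : ZMod 4) = 1 := by decide
  have hk : k = 0 ∨ k = 1 ∨ k = 2 ∨ k = 3 := by revert k; decide
  rcases hk with rfl | rfl | rfl | rfl
  · simp only [zero_add, dirX_zero, dirY_zero, add_zero, inflatedD_zero, inflatedD_two,
      inflatedRev, g.rot_D, g.rev_D, e1, e2, m0, m1]
    split_ifs with hc
    · obtain ⟨q, r⟩ := cell_add_one_of_lt hc
      rw [q, r]
    · obtain ⟨q, r⟩ := cell_add_one_of_eq (show cellPos v x + 1 = v by omega)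
      rw [q, r, (mult_D hh hv _ _).2.2.2, Nat.sub_zero]
  · simp only [f1, dirX_one, dirY_one, add_zero, inflatedD_one, inflatedD_three,
      inflatedRev, g.rot_D, g.rev_D, e1, e2, e3, m1, m2]
    have h3 : v - 1 - (v - 1 - cellPos v x) = cellPos v x := by omega
    rw [h3]
    split_ifs with hc
    · obtain ⟨q, r⟩ := cell_add_one_of_lt hc
      rw [q, r]
    · obtain ⟨q, r⟩ := cell_add_one_of_eq (show cellPos h y + 1 = h by omega)
      rw [q, r, (mult_D hh hv _ _).1, Nat.sub_zero]
  · simp only [f2, dirX_two, dirY_two, add_zero, inflatedD_two, inflatedD_zero,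
      inflatedRev, g.rot_D, g.rev_D, zero_add, e2, e3, m2, m3, ← sub_eq_add_neg]
    have h3 : h - 1 - (h - 1 - cellPos h y) = cellPos h y := by omega
    rw [h3]
    split_ifs with hc
    · obtain ⟨q, r⟩ := cell_sub_one_of_pos hv0 (x := x) (by omega)
      rw [q, r, show v - 1 - (v - 1 - cellPos v x + 1) = cellPos v x - 1 by omega]
    · obtain ⟨q, r⟩ := cell_sub_one_of_eq hv0 (x := x) (by omega)
      rw [q, r, (mult_D hh hv _ _).2.1]
  · simp only [f3, dirX_three, dirY_three, add_zero, inflatedD_three, inflatedD_one,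
      inflatedRev, g.rot_D, g.rev_D, zero_add, e1, e3, m0, m3, ← sub_eq_add_neg]
    split_ifs with hc
    · obtain ⟨q, r⟩ := cell_sub_one_of_pos hh0 (x := y) (by omega)
      rw [q, r, show h - 1 - (h - 1 - cellPos h y + 1) = cellPos h y - 1 by omega]
    · obtain ⟨q, r⟩ := cell_sub_one_of_eq hh0 (x := y) (by omega)
      rw [q, r, (mult_D hh hv _ _).2.2.1]

theorem inflatedD_surj (hh : ∀ y, (t (g.hor y) : ℕ) = h)
    (hv : ∀ x, (t (g.ver x) : ℕ) = v) (p : H.Dart × ℕ × ℕ) (hp : H.IsInflatedDart t p) :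
    ∃ x y k, g.inflatedD v h x y k = p := by
  have key : ∀ p, H.IsInflatedDart t p → (∃ x y, p.1 = g.D x y 0) →
      ∃ x y k, g.inflatedD v h x y k = p := by
    rintro ⟨d, a, b⟩ ⟨ha, hb⟩ ⟨q, q', hd⟩
    dsimp only at hd ha hb
    subst hd
    obtain ⟨m0, m1, -, -⟩ := mult_D hh hv q q'
    rw [g.rot_D, zero_add, m1] at ha
    rw [m0] at hb
    obtain ⟨h1, h2⟩ := cell_eq ha (rfl : (v * (q - 1) + a + 1 : ℤ) = _)
    obtain ⟨h3, h4⟩ := cell_eq hb (rfl : (h * (q' - 1) + b + 1 : ℤ) = _)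
    exact ⟨_, _, 0, by rw [inflatedD_zero, h1, h2, h3, h4]⟩
  have hrot : ∀ p, H.IsInflatedDart t p → (∃ x y k, g.inflatedD v h x y k = H.inflatedRot t p) →
      ∃ x y k, g.inflatedD v h x y k = p := by
    rintro p hp ⟨x, y, k, hk⟩
    -- Three further quarter turns undo the one already made.
    refine ⟨x, y, k + 1 + 1 + 1, ?_⟩
    simp only [← inflatedRot_inflatedD hh hv, hk, H.inflatedRot_four t p hp]
  have key3 : ∀ p, H.IsInflatedDart t p → (∃ x y, p.1 = g.D x y 3) →
      ∃ x y k, g.inflatedD v h x y k = p := by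
    rintro p hp ⟨x, y, hd⟩
    exact hrot p hp (key _ (H.isInflatedDart_rot t p hp) ⟨x, y, by
      rw [inflatedRot, hd, g.rot_D]; rfl⟩)
  have key2 : ∀ p, H.IsInflatedDart t p → (∃ x y, p.1 = g.D x y 2) →
      ∃ x y k, g.inflatedD v h x y k = p := by
    rintro p hp ⟨x, y, hd⟩
    exact hrot p hp (key3 _ (H.isInflatedDart_rot t p hp) ⟨x, y, by
      rw [inflatedRot, hd, g.rot_D]; rfl⟩)
  obtain ⟨x, y, k, hd⟩ := g.surj p.1
  have hk : k = 0 ∨ k = 1 ∨ k = 2 ∨ k = 3 := by clear hd; revert k; decide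
  rcases hk with rfl | rfl | rfl | rfl
  · exact key p hp ⟨x, y, hd.symm⟩
  · exact hrot p hp (key2 _ (H.isInflatedDart_rot t p hp) ⟨x, y, by
      rw [inflatedRot, ← hd, g.rot_D]; rfl⟩)
  · exact key2 p hp ⟨x, y, hd.symm⟩
  · exact key3 p hp ⟨x, y, hd.symm⟩

/-- The inflation stretches the lattice in both directions. -/
theorem exists_grid_inflate (hh : ∀ y, (t (g.hor y) : ℕ) = h) (hv : ∀ x, (t (g.ver x) : ℕ) = v) :
    ∃ g' : (H.inflate t).Grid, ∀ a b, (a, b) ∈ g'.L ↔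
      ∃ a' b' : ℤ, (a', b') ∈ g.L ∧ a = v * a' ∧ b = h * b' := by
  have hv0 : 0 < v := hv 0 ▸ (t (g.ver 0)).pos
  have hh0 : 0 < h := hh 0 ▸ (t (g.hor 0)).pos
  have hmem (a b : ℤ) : (a, b) ∈ g.L.map
      (AddMonoidHom.prodMap (AddMonoidHom.mulLeft (v : ℤ)) (AddMonoidHom.mulLeft (h : ℤ))) ↔
      ∃ a' b' : ℤ, (a', b') ∈ g.L ∧ a = v * a' ∧ b = h * b' := by
    rw [AddSubgroup.mem_map]
    constructor
    · rintro ⟨⟨a', b'⟩, h, h2⟩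
      exact ⟨a', b', h, (congrArg Prod.fst h2).symm, (congrArg Prod.snd h2).symm⟩
    · rintro ⟨a', b', h, rfl, rfl⟩
      exact ⟨(a', b'), h, rfl⟩
  refine ⟨{
    D := fun x y k => ⟨g.inflatedD v h x y k, isInflatedDart_inflatedD hh hv x y k⟩
    rot_D := fun x y k => Subtype.ext (inflatedRot_inflatedD hh hv x y k)
    rev_D := fun x y k => Subtype.ext (inflatedRev_inflatedD hh hv x y k)
    surj := fun d => ?_
    L := g.L.map
      (AddMonoidHom.prodMap (AddMonoidHom.mulLeft (v : ℤ)) (AddMonoidHom.mulLeft (h : ℤ)))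
    half := Subtype.ext ?_
    zero_iff := fun x y x' y' => ?_
    ne_one := fun x y x' y' hd => ?_ }, hmem⟩
  · obtain ⟨x, y, k, hd⟩ := inflatedD_surj hh hv d.1 d.2
    exact ⟨x, y, k, Subtype.ext hd⟩
  · change g.inflatedD v h 0 0 0 = g.inflatedD v h 1 1 2
    -- Cells `0` and `1` meet at `1/2`, so the half turn about `(1/2, 1/2)` exchanges them and
    -- reverses positions.
    have h0 (n : ℕ) (hn : 0 < n) : cell n 0 = 0 ∧ cellPos n 0 = n - 1 :=
      cell_eq (by omega) (by rw [Nat.cast_sub (by omega)]; push_cast; ring)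
    have h1 (n : ℕ) (hn : 0 < n) : cell n 1 = 1 ∧ cellPos n 1 = 0 :=
      cell_eq (by omega) (by push_cast; ring)
    rw [inflatedD_zero, inflatedD_two, (h0 v hv0).1, (h0 v hv0).2, (h0 h hh0).1, (h0 h hh0).2,
      (h1 v hv0).1, (h1 v hv0).2, (h1 h hh0).1, (h1 h hh0).2, Nat.sub_zero, Nat.sub_zero, g.half]
  · simp only [hmem]
    refine Subtype.ext_iff.trans ?_
    change g.inflatedD v h x y 0 = g.inflatedD v h x' y' 0 ↔ _
    rw [inflatedD_zero, inflatedD_zero, Prod.mk.injEq, Prod.mk.injEq, g.zero_iff]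
    have hx := cell_spec hv0 x
    have hy := cell_spec hh0 y
    have hx' := cell_spec hv0 x'
    have hy' := cell_spec hh0 y'
    constructor
    -- Points at equal positions in their cells differ by `v` and `h` times the differences of the
    -- cell indices.
    · rintro ⟨⟨a, b, hab, h1, h2⟩, h3, h4⟩
      rw [h1, ← h3] at hx'
      rw [h2, ← h4] at hy'
      exact ⟨v * a, h * b, ⟨a, b, hab, rfl, rfl⟩, by linear_combination hx'.2 - hx.2,
        by linear_combination hy'.2 - hy.2⟩
    · rintro ⟨_, _, ⟨a, b, hab, rfl, rfl⟩, h1, h2⟩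
      obtain ⟨h3, h4⟩ := cell_eq (x := x') (q := cell v x + 2 * a) hx.1
        (by linear_combination h1 + hx.2)
      obtain ⟨h5, h6⟩ := cell_eq (x := y') (q := cell h y + 2 * b) hy.1
        (by linear_combination h2 + hy.2)
      exact ⟨⟨a, b, hab, h3, h5⟩, h4.symm, h6.symm⟩
  · exact g.ne_one _ _ _ _ (congrArg (fun d => d.1.1) hd)

end Grid

end FourValentMap

/-! ### The parts of the theorem -/

namespace FourValentMap

namespace Grid

variable {G : FourValentMap} {g : G.Grid}

theorem isFull_of_dvd {u : ℕ} {s : ℤ} (hus : IsCoprime (u : ℤ) s)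
    (hL : ∀ x y, (x, y) ∈ g.L ↔ (u : ℤ) ∣ x - s * y) : g.IsFull := by
  obtain ⟨p, q, hpq⟩ := hus
  exact ⟨⟨s, (hL _ _).2 (by simp)⟩, ⟨q, (hL _ _).2 ⟨p, by linear_combination -hpq⟩⟩⟩

theorem numVertices_of_dvd (hg : g.IsFull) {u : ℕ} {s : ℤ}
    (hL : ∀ x y, (x, y) ∈ g.L ↔ (u : ℤ) ∣ x - s * y) : G.numVertices = 2 * u :=
  numVertices_eq (fun a => by simpa using hL a 0) fun y => hg.hor_eq y 0

end Grid

theorem IsHedrite.exists_isFull {G : FourValentMap} (hG : G.IsHedrite 4)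
    (h2 : Nat.card G.CentralCircuit = 2) : ∃ g : G.Grid, g.IsFull := by
  obtain ⟨g⟩ := hG.exists_grid
  exact ⟨g, g.card_circuit_eq_two_iff.1 h2⟩

/-- In normal form, `L` is `diag (v, h)` applied to the full lattice of `spiral u s`. So the
horizontal circuit is taken `h` times and the vertical one `v` times. -/
theorem IsHedrite.exists_inflate {G : FourValentMap} (hG : G.IsHedrite 4) :
    ∃ H : FourValentMap, H.IsHedrite 4 ∧ Nat.card H.CentralCircuit = 2 ∧
      ∃ t : H.CentralCircuit → ℕ+, G.Iso (H.inflate t) := by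
  classical
  obtain ⟨g⟩ := hG.exists_grid
  obtain ⟨v, h, u, s, v0, h0, u0, hus, hL⟩ := g.exists_normal_form
  obtain ⟨gH, hH⟩ := exists_grid_spiral u s u0
  have hf := Grid.isFull_of_dvd hus hH
  obtain ⟨t, hh, hv⟩ : ∃ t : (spiral u s u0).CentralCircuit → ℕ+,
      (∀ y, (t (gH.hor y) : ℕ) = h) ∧ ∀ x, (t (gH.ver x) : ℕ) = v :=
    ⟨fun C => if C = gH.hor 0 then h.toPNat h0 else v.toPNat v0,
      fun y => by simp only [if_pos (hf.hor_eq y 0)]; rfl,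
      fun x => by simp only [if_neg (gH.hor_ne_ver x 0).symm]; rfl⟩
  refine ⟨_, hf.isHedrite, gH.card_circuit_eq_two_iff.2 hf, t, ?_⟩
  obtain ⟨g', hg'⟩ := Grid.exists_grid_inflate hh hv
  refine Grid.iso_of_lattice g g' 1 (.inl rfl) fun a b => ?_
  rw [hL, one_mul, hg']
  simp only [hH]
  constructor
  · rintro ⟨i, j, rfl, rfl⟩
    exact ⟨_, _, ⟨i, by ring⟩, rfl, rfl⟩
  · rintro ⟨a', j, ⟨i, hi⟩, rfl, rfl⟩
    exact ⟨i, j, by linear_combination (v : ℤ) * hi, rfl⟩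

/-- Stretching a full lattice makes its projections the multiples of the two multiplicities, and a
reflection does not affect this. They are everything only when both multiplicities are one. -/
theorem IsHedrite.isIrreducible_iff_of_iso_inflate {G H : FourValentMap} (hH : H.IsHedrite 4)
    (h2 : Nat.card H.CentralCircuit = 2) (t : H.CentralCircuit → ℕ+) (hiso : G.Iso (H.inflate t)) :
    G.IsIrreducible ↔ ∀ C, t C = 1 := by
  obtain ⟨g, hg⟩ := hH.exists_isFull h2
  obtain ⟨g', hg'⟩ := Grid.exists_grid_inflate (g := g) (t := t)
    (fun y => by rw [hg.hor_eq y 0]) (fun x => by rw [hg.ver_eq x 0])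
  obtain ⟨gG, ε, hε, hgG⟩ := Grid.exists_of_iso g' hiso
  rw [gG.isIrreducible_iff]
  have h1 : (∀ C, t C = 1) ↔ (t (g.hor 0) : ℕ) = 1 ∧ (t (g.ver 0) : ℕ) = 1 := by
    constructor
    · exact fun h => ⟨by rw [h]; rfl, by rw [h]; rfl⟩
    · rintro ⟨h, h'⟩ C
      rcases g.circuit_cases C with ⟨y, rfl⟩ | ⟨x, rfl⟩
      · rw [hg.hor_eq y 0]; exact PNat.eq h
      · rw [hg.ver_eq x 0]; exact PNat.eq h'
  rw [h1]
  have hεε : ε * ε = 1 := by rcases hε with rfl | rfl <;> rfl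
  constructor
  · rintro ⟨⟨a, ha⟩, ⟨b, hb⟩⟩
    rw [hgG, hg'] at ha hb
    obtain ⟨_, b', -, -, h3⟩ := ha
    obtain ⟨a', _, -, h4, -⟩ := hb
    constructor
    · have : ((t (g.hor 0) : ℕ) : ℤ) ∣ ((1 : ℕ) : ℤ) := ⟨b', by simpa using h3⟩
      exact Nat.dvd_one.1 (Int.natCast_dvd_natCast.1 this)
    · have : ((t (g.ver 0) : ℕ) : ℤ) ∣ ((1 : ℕ) : ℤ) := ⟨ε * a', by
        push_cast
        linear_combination -hεε + ε * h4⟩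
      exact Nat.dvd_one.1 (Int.natCast_dvd_natCast.1 this)
  · rintro ⟨hh, hv⟩
    have hmem (a b : ℤ) : (ε * a, b) ∈ gG.L ↔ (a, b) ∈ g.L := by
      rw [hgG, hg', hh, hv, ← mul_assoc, hεε]
      simp
    obtain ⟨⟨a, ha⟩, ⟨b, hb⟩⟩ := hg
    refine ⟨⟨ε * a, (hmem _ _).2 ha⟩, ?_⟩
    rcases hε with rfl | rfl
    · exact ⟨b, by simpa using (hmem 1 b).2 hb⟩
    · exact ⟨-b, by simpa using gG.L.neg_mem ((hmem 1 b).2 hb)⟩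

theorem IsHedrite.exists_shift {G : FourValentMap} (hG : G.IsHedrite 4)
    (h2 : Nat.card G.CentralCircuit = 2) : Even G.numVertices ∧
      ∀ C : G.CentralCircuit, ∃ j : ℕ,
        4 * j ≤ G.numVertices ∧ Nat.gcd (G.numVertices / 2) j = 1 ∧ G.IsShift C j ∧
        ∀ j' : ℕ, 4 * j' ≤ G.numVertices → G.IsShift C j' → j' = j := by
  obtain ⟨g, hg⟩ := hG.exists_isFull h2
  refine ⟨hg.exists_shift.1, fun C => ?_⟩
  obtain ⟨g', hg', rfl⟩ := hg.exists_hor C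
  exact hg'.exists_shift.2

theorem IsHedrite.iso_of_isShift {G G' : FourValentMap} (hG : G.IsHedrite 4)
    (h2 : Nat.card G.CentralCircuit = 2) (hG' : G'.IsHedrite 4)
    (h2' : Nat.card G'.CentralCircuit = 2) (hn : G.numVertices = G'.numVertices)
    (C : G.CentralCircuit) (C' : G'.CentralCircuit) (j : ℕ) (hj : G.IsShift C j)
    (hj' : G'.IsShift C' j) : G.Iso G' := by
  obtain ⟨g, hg⟩ := hG.exists_isFull h2
  obtain ⟨g', hg'⟩ := hG'.exists_isFull h2'
  obtain ⟨f, hf, rfl⟩ := hg.exists_hor C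
  obtain ⟨f', hf', rfl⟩ := hg'.exists_hor C'
  exact hf.iso hf' hn hj hj'

theorem exists_isHedrite_isShift (n j : ℕ) (hn : Even n) (hj : 4 * j ≤ n)
    (hc : Nat.gcd (n / 2) j = 1) :
    ∃ G : FourValentMap, G.IsHedrite 4 ∧ Nat.card G.CentralCircuit = 2 ∧ G.numVertices = n ∧
      ∃ C : G.CentralCircuit, G.IsShift C j := by
  obtain ⟨u, rfl⟩ := hn.two_dvd
  rw [Nat.mul_div_cancel_left _ two_pos] at hc
  -- For `n = 0` the bound forces `j = 0`, but `gcd 0 0 = 0`.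
  have hu : 0 < u := by
    rcases Nat.eq_zero_or_pos u with rfl | hu
    · obtain rfl : j = 0 := by omega
      simp at hc
    · exact hu
  obtain ⟨g, hL⟩ := exists_grid_spiral u j hu
  have hg := Grid.isFull_of_dvd (Nat.isCoprime_iff_coprime.2 hc) hL
  exact ⟨_, hg.isHedrite, g.card_circuit_eq_two_iff.2 hg, Grid.numVertices_of_dvd hg hL, g.hor 0,
    (hg.isShift_iff j).2 (.inl ((hL _ _).2 (by simp)))⟩

theorem exists_two_shifts :
    ∃ G : FourValentMap, G.IsHedrite 4 ∧ Nat.card G.CentralCircuit = 2 ∧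
      ∃ (C C' : G.CentralCircuit) (j j' : ℕ), 4 * j ≤ G.numVertices ∧ 4 * j' ≤ G.numVertices ∧
        G.IsShift C j ∧ G.IsShift C' j' ∧ j ≠ j' := by
  -- The two shifts are inverse to each other modulo `u` up to sign: `2 * 3 ≡ -1` modulo `7`, and
  -- both are at most `14 / 4`.
  obtain ⟨g, hL⟩ := exists_grid_spiral 7 2 (by norm_num)
  have hg : g.IsFull := Grid.isFull_of_dvd ⟨1, -3, by norm_num⟩ hL
  have hn := Grid.numVertices_of_dvd hg hL
  refine ⟨_, hg.isHedrite, g.card_circuit_eq_two_iff.2 hg, g.hor 0, g.turn.hor 0, 2, 3,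
    by omega, by omega, (hg.isShift_iff 2).2 (.inl ((hL _ _).2 (by norm_num))),
    (hg.turn.isShift_iff 3).2 (.inl ?_), by norm_num⟩
  rw [Grid.mem_turn, hL]
  norm_num

end FourValentMap

theorem mainTheorem6 :
    -- every 4-hedrite is an inflation of one with two central circuits; irreducibility
    (∀ G : FourValentMap, G.IsHedrite 4 →
      (∃ H : FourValentMap, H.IsHedrite 4 ∧ Nat.card H.CentralCircuit = 2 ∧
        ∃ t : H.CentralCircuit → ℕ+, G.Iso (H.inflate t)) ∧
      (∀ H : FourValentMap, H.IsHedrite 4 → Nat.card H.CentralCircuit = 2 →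
        ∀ t : H.CentralCircuit → ℕ+, G.Iso (H.inflate t) →
          (G.IsIrreducible ↔ ∀ C, t C = 1))) ∧
    -- a 4-hedrite with two central circuits has a shift relative to each of them
    (∀ G : FourValentMap, G.IsHedrite 4 → Nat.card G.CentralCircuit = 2 →
      Even G.numVertices ∧
      ∀ C : G.CentralCircuit, ∃ j : ℕ,
        4 * j ≤ G.numVertices ∧ Nat.gcd (G.numVertices / 2) j = 1 ∧ G.IsShift C j ∧
        ∀ j' : ℕ, 4 * j' ≤ G.numVertices → G.IsShift C j' → j' = j) ∧
    -- the number of vertices and a shift determine it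
    (∀ G G' : FourValentMap, G.IsHedrite 4 → Nat.card G.CentralCircuit = 2 →
      G'.IsHedrite 4 → Nat.card G'.CentralCircuit = 2 → G.numVertices = G'.numVertices →
      ∀ (C : G.CentralCircuit) (C' : G'.CentralCircuit) (j : ℕ), 4 * j ≤ G.numVertices →
        G.IsShift C j → G'.IsShift C' j → G.Iso G') ∧
    -- all the admissible values occur
    (∀ n j : ℕ, Even n → 4 * j ≤ n → Nat.gcd (n / 2) j = 1 →
      ∃ G : FourValentMap, G.IsHedrite 4 ∧ Nat.card G.CentralCircuit = 2 ∧ G.numVertices = n ∧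
        ∃ C : G.CentralCircuit, G.IsShift C j) ∧
    -- different values of the shift can yield the same graph
    (∃ G : FourValentMap, G.IsHedrite 4 ∧ Nat.card G.CentralCircuit = 2 ∧
      ∃ (C C' : G.CentralCircuit) (j j' : ℕ), 4 * j ≤ G.numVertices ∧ 4 * j' ≤ G.numVertices ∧
        G.IsShift C j ∧ G.IsShift C' j' ∧ j ≠ j') ∧
    -- every 4-hedrite is balanced
    (∀ G : FourValentMap, G.IsHedrite 4 → G.IsBalanced) := by

  open FourValentMap in
  exact ⟨fun G hG => ⟨hG.exists_inflate, fun H hH h2 t ht =>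
      hH.isIrreducible_iff_of_iso_inflate h2 t ht⟩,
    fun G hG h2 => hG.exists_shift h2,
    fun G G' hG h2 hG' h2' hn C C' j _ hj hj' =>
      hG.iso_of_isShift h2 hG' h2' hn C C' j hj hj',
    exists_isHedrite_isShift, exists_two_shifts,
    fun G hG => hG.exists_grid.elim fun g => g.isBalanced⟩
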